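/- Let $p\ge 3$ and consider the linear models $Y_n=X_n\beta+(e_1,\dots,e_n)'$, $n\ge 1$, where $\beta\in\mathbb R^p$, $e_1,e_2,\dots$ are i.i.d. with mean $0$ and variance $\sigma^2\in(0,\infty)$, and the $X_n$ are (non-random) $n\times p$ design matrices with rows $x_{n,1}',\dots,x_{n,n}'$ such that $$\tfrac1n X_n'X_n\to C \ \text{ with } C \text{ positive definite},\qquad \tfrac1n\max_{1\le j\le n}x_{n,j}'\big(\tfrac1nX_n'X_n\big)^{-1}x_{n,j}\to 0 .$$ Let $\tilde\beta_n=(X_n'X_n)^{-1}X_n'Y_n$ be the least squares estimator, $s_n^2=(n-p)^{-1}\|Y_n-X_n\tilde\beta_n\|^2$, and $\mathcal L_n=\tilde\beta_n'X_n'X_n\tilde\beta_n/s_n^2$. For $\alpha\in(0,1)$ let $\chi^2_p(\alpha)$ be the upper $\alpha$-level critical value of the central chi-square distribution with $p$ degrees of freedom, and define the preliminary test estimator and the improved preliminary test estimator of $\beta$ by $$\hat\beta_n^{PT}=\tilde\beta_n-\tilde\beta_n\,I\big(\mathcal L_n<\chi^2_p(\alpha)\big),\qquad \hat\beta_n^{IPT}=\hat\beta_n^{PT}\big(1-(p-2)\mathcal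 L_n^{-1}\big).$$ For $\delta\in\mathbb R^p\setminus\{0\}$ consider the local alternatives $\beta=\beta_{(n)}=\delta/\sqrt n$. The asymptotic distributional quadratic risk (ADQR) of a sequence of estimators $\beta_n^*$ at $\delta$ (for the loss $n\|\beta_n^*-\beta\|^2$) is $\int\|x\|^2\,dG(x)$, where $G$ is the limit in distribution of $\sqrt n(\beta_n^*-\beta_{(n)})$ under $\beta=\beta_{(n)}$. Assume that $$\frac{\operatorname{tr}C^{-1}}{\mathrm{Ch}_{\max}(C^{-1})}\ \ge\ \frac{p+2}{2},$$ where $\mathrm{Ch}_{\max}$ denotes the largest eigenvalue (for $C=I_p$ this always holds). Theorem. For every $\alpha\in(0,1)$ and every $\delta\ne 0$, that is, for every value of $(\alpha,\Delta^2)\in(0,1)\times(0,\infty)$, where $\Delta^2=\delta'C\delta/\sigma^2$, the ADQRs of $\hat\beta_n^{PT}$ and $\hat\beta_n^{IPT}$ exist and are finite, and $\hat\beta_n^{IPT}$ dominates $\hat\beta_n^{PT}$: for every $\alpha\in(0,1)$, $$ADQR(\hat\beta_n^{IPT};\delta)\le ADQR(\hat\beta_n^{PT};\delta)\quad\text{for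 all }\delta\ne0,$$ with strict inequality for at least one $\delta\neq 0$. -/

import Mathlib

open MeasureTheory ProbabilityTheory Filter Topology Matrix

noncomputable section

namespace LinReg

/-- Least squares estimator `(XᵀX)⁻¹ Xᵀ Y` in the linear model with `n × p` design matrix `X`. -/
def lse {n p : ℕ} (X : Matrix (Fin n) (Fin p) ℝ) (Y : Fin n → ℝ) : Fin p → ℝ :=
  (Xᵀ * X)⁻¹ *ᵥ (Xᵀ *ᵥ Y)

/-- Residual variance estimator `s² = (n - p)⁻¹ (Y - X β̃)ᵀ (Y - X β̃)`, with `β̃` the LSE. -/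
def residVar {n p : ℕ} (X : Matrix (Fin n) (Fin p) ℝ) (Y : Fin n → ℝ) : ℝ :=
  ((n : ℝ) - (p : ℝ))⁻¹ * ((Y - X *ᵥ lse X Y) ⬝ᵥ (Y - X *ᵥ lse X Y))

/-- Test statistic `L = β̃ᵀ (XᵀX) β̃ / s²` for the hypothesis `β = 0`. -/
def testStat {n p : ℕ} (X : Matrix (Fin n) (Fin p) ℝ) (Y : Fin n → ℝ) : ℝ :=
  (lse X Y ⬝ᵥ ((Xᵀ * X) *ᵥ lse X Y)) / residVar X Y

/-- Central chi-square distribution with `p` degrees of freedom: the gamma distribution with shape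
`p / 2` and rate `1 / 2`. -/
def chiSq (p : ℕ) : Measure ℝ := gammaMeasure ((p : ℝ) / 2) (1 / 2)

/-- Upper `α`-level critical value of the central chi-square distribution with `p` degrees of
freedom (the point `c` with `P(χ²_p > c) = α`, for `0 < α < 1`). -/
def chiSqCrit (p : ℕ) (α : ℝ) : ℝ :=
  sInf {c : ℝ | chiSq p (Set.Ioi c) ≤ ENNReal.ofReal α}

open Classical in
/-- Preliminary test estimator `β̃ - β̃ · 1(L < χ²_p(α))`. -/
def prelimTest {n p : ℕ} (α : ℝ) (X : Matrix (Fin n) (Fin p) ℝ) (Y : Fin n → ℝ) : Fin p → ℝ :=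
  lse X Y - (if testStat X Y < chiSqCrit p α then (1 : ℝ) else 0) • lse X Y

/-- Improved preliminary test estimator `β^PT · (1 - (p - 2) L⁻¹)`. -/
def improvedPrelimTest {n p : ℕ} (α : ℝ) (X : Matrix (Fin n) (Fin p) ℝ) (Y : Fin n → ℝ) :
    Fin p → ℝ :=
  (1 - ((p : ℝ) - 2) * (testStat X Y)⁻¹) • prelimTest α X Y

/-- Local alternative `β_(n) = n^{-1/2} δ`. -/
def localAlt {p : ℕ} (δ : Fin p → ℝ) (n : ℕ) : Fin p → ℝ := (√(n : ℝ))⁻¹ • δ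

/-- The response `Y = X β_(n) + (e_0, …, e_{n-1})` under the local alternative. -/
def response {Ω : Type*} {p : ℕ} (X : ∀ n : ℕ, Matrix (Fin n) (Fin p) ℝ) (e : ℕ → Ω → ℝ)
    (δ : Fin p → ℝ) (n : ℕ) (ω : Ω) : Fin n → ℝ :=
  X n *ᵥ localAlt δ n + fun i : Fin n => e i ω

/-- `r` is the asymptotic distributional quadratic risk of the estimators `T n` of the parameters
`b n`, for the loss `n (T - b)ᵀ W (T - b)`: the random vectors `√n (T n - b n)` converge in
distribution to some law `G`, the form `xᵀ W x` is `G`-integrable, and `r = ∫ xᵀ W x dG(x)`.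
(`G`, hence `r`, is unique, as a weak limit.) -/
def HasADQR {Ω : Type*} [MeasurableSpace Ω] (P : Measure Ω) [IsProbabilityMeasure P] {p : ℕ}
    (W : Matrix (Fin p) (Fin p) ℝ) (b : ℕ → Fin p → ℝ) (T : ℕ → Ω → Fin p → ℝ) (r : ℝ) : Prop :=
  ∃ (G : Measure (Fin p → ℝ)) (_ : IsProbabilityMeasure G),
    TendstoInDistribution (fun (n : ℕ) (ω : Ω) => √(n : ℝ) • (T n ω - b n)) atTop
      (id : (Fin p → ℝ) → Fin p → ℝ) (fun _ => P) G ∧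
    Integrable (fun x => x ⬝ᵥ (W *ᵥ x)) G ∧
    r = ∫ x, x ⬝ᵥ (W *ᵥ x) ∂G

/-- The largest characteristic root (eigenvalue) of a symmetric real matrix. -/
def chMax {p : ℕ} (A : Matrix (Fin p) (Fin p) ℝ) : ℝ := sSup (spectrum ℝ A)

/-- Risk function `R` dominates risk function `R'` over the parameters `δ ≠ 0`: it is nowhere
larger, and it is smaller somewhere. -/
def Dominates {p : ℕ} (R R' : (Fin p → ℝ) → ℝ) : Prop :=
  (∀ δ, δ ≠ 0 → R δ ≤ R' δ) ∧ ∃ δ, δ ≠ 0 ∧ R δ < R' δ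

end LinReg

end

namespace LinReg

/-! Under the local alternatives `√n β̃` converges in law to `D v` with `v ~ N(θ, I)`, `D Dᵀ = σ²
C⁻¹` and `D θ = δ`, while the test statistic converges jointly to `L = v ⬝ᵥ v`. Both estimators have
the form `f(testStat) • β̃` with `f` discontinuous at most at the critical value `c`, which `L` hits
with probability zero, so continuous mapping gives their limit laws. With `D = σ U diag(√l)`, where
`U` and `l` are eigenvectors and eigenvalues of `C⁻¹`, the risk becomes `σ² E ∑ lᵢ (f(L) vᵢ - θᵢ)²`
(`hasADQR_shrink`).

What remains is a comparison in the Gaussian model (`integral_shrinkLoss_iptFactor_lt`). The cross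
terms `E[vᵢ (vᵢ - θᵢ) / L; L ≥ c]` are treated by Stein's integration by parts in each coordinate.
Truncating `x / (x² + S)` to `x² + S ≥ c` creates only upward jumps, so the boundary terms have the
favourable sign. The risk reduction is then at least a positive multiple of `E[∑ (2 ∑ l - (p + 2)
lᵢ) vᵢ² / L²; L ≥ c]`. The trace condition makes these coefficients nonnegative, and their sum `(p -
2) ∑ l` is positive, so the improvement is strict at every `δ`. -/

/-! ### Positivity of the chi-square critical value. -/

lemma chiSq_Iic_zero (p : ℕ) : chiSq p (Set.Iic 0) = 0 := by
  rw [chiSq, gammaMeasure, withDensity_apply _ measurableSet_Iic]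
  rw [setLIntegral_congr Iio_ae_eq_Iic.symm]
  exact lintegral_gammaPDF_of_nonpos le_rfl

/-- Since the law has no mass on `(-∞, 0]`, right continuity of the cdf at `0` keeps it below `1 -
α` up to some `ε > 0`, and `ε` bounds the critical value from below. Positivity is what keeps `L⁻¹`
bounded where the estimator is not zero. -/
lemma chiSqCrit_pos {p : ℕ} (hp : 0 < p) {α : ℝ} (hα : α ∈ Set.Ioo (0 : ℝ) 1) :
    0 < chiSqCrit p α := by
  have hprob : IsProbabilityMeasure (chiSq p) :=
    isProbabilityMeasure_gammaMeasure (by positivity) (by norm_num)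
  have hiff (c : ℝ) : chiSq p (Set.Ioi c) ≤ ENNReal.ofReal α ↔ 1 - cdf (chiSq p) c ≤ α := by
    rw [← ENNReal.ofReal_toReal (measure_ne_top (chiSq p) (Set.Ioi c)),
      ENNReal.ofReal_le_ofReal_iff hα.1.le, cdf_eq_real, ← probReal_compl_eq_one_sub
        measurableSet_Iic, Set.compl_Iic]
    rfl
  have h0 : cdf (chiSq p) 0 = 0 := by
    rw [cdf_eq_real, measureReal_def, chiSq_Iic_zero, ENNReal.toReal_zero]
  obtain ⟨ε, hε, hεlt⟩ : ∃ ε : ℝ, 0 < ε ∧ cdf (chiSq p) ε < 1 - α := by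
    have hcont : Tendsto (cdf (chiSq p)) (𝓝[>] 0) (𝓝 (cdf (chiSq p) 0)) :=
      ((cdf (chiSq p)).right_continuous 0).tendsto.mono_left
        (nhdsWithin_mono _ Set.Ioi_subset_Ici_self)
    rw [h0] at hcont
    have hev := (hcont.eventually_lt_const (sub_pos.2 hα.2)).and self_mem_nhdsWithin
    obtain ⟨ε, h1, h2⟩ := hev.exists
    exact ⟨ε, h2, h1⟩
  obtain ⟨d, hd⟩ : ∃ d : ℝ, 1 - α < cdf (chiSq p) d :=
    ((tendsto_cdf_atTop (chiSq p)).eventually_const_lt (by linarith [hα.1])).exists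
  refine hε.trans_le (le_csInf ⟨d, (hiff d).2 (by linarith)⟩ fun c hc ↦ ?_)
  by_contra! hlt
  have h1 := (hiff c).1 hc
  have h2 := (cdf (chiSq p)).mono hlt.le
  linarith

/-! ### Stein's inequality in one variable, with truncation. -/

/-- The integrand arising from Stein's identity for `x / (x ^ 2 + S)` under a normal law with mean
`θ` and unit variance. -/
noncomputable def steinKernel (θ S x : ℝ) : ℝ :=
  x * (x - θ) / (x ^ 2 + S) - 1 / (x ^ 2 + S) + 2 * x ^ 2 / (x ^ 2 + S) ^ 2

/-- Truncation keeps the denominator above `c`; the bound is uniform in `x` and `S`, so it also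
gives integrability in the multivariate case. -/
lemma abs_steinKernel_le {c θ S x : ℝ} (hc : 0 < c) (hS : 0 ≤ S) (h : c ≤ x ^ 2 + S) :
    |steinKernel θ S x| ≤ 2 + θ ^ 2 / c + 3 / c := by
  have hq : 0 < x ^ 2 + S := hc.trans_le h
  have h1 : |x * (x - θ) / (x ^ 2 + S)| ≤ 2 + θ ^ 2 / c := by
    have : θ ^ 2 / (x ^ 2 + S) ≤ θ ^ 2 / c := by gcongr
    have h3 : |x * (x - θ)| / (x ^ 2 + S) ≤ 2 + θ ^ 2 / (x ^ 2 + S) := by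
      rw [div_le_iff₀ hq, add_mul, div_mul_cancel₀ _ hq.ne', abs_le]
      constructor <;> nlinarith [sq_nonneg (x - θ), sq_nonneg (x + θ)]
    rw [abs_div, abs_of_pos hq]
    linarith
  have h2 : |1 / (x ^ 2 + S)| ≤ 1 / c := by
    rw [abs_of_pos (by positivity)]; gcongr
  have h3 : |2 * x ^ 2 / (x ^ 2 + S) ^ 2| ≤ 2 / c := by
    rw [abs_of_nonneg (by positivity)]
    calc 2 * x ^ 2 / (x ^ 2 + S) ^ 2 ≤ 2 * (x ^ 2 + S) / (x ^ 2 + S) ^ 2 := by gcongr; linarith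
      _ = 2 / (x ^ 2 + S) := by field_simp
      _ ≤ 2 / c := by gcongr
  have h4 := abs_add_le (x * (x - θ) / (x ^ 2 + S) - 1 / (x ^ 2 + S))
    (2 * x ^ 2 / (x ^ 2 + S) ^ 2)
  have h5 := abs_sub (x * (x - θ) / (x ^ 2 + S)) (1 / (x ^ 2 + S))
  have h6 : (3 : ℝ) / c = 1 / c + 2 / c := by ring
  rw [steinKernel]
  linarith

lemma measurable_steinKernel (θ S : ℝ) : Measurable (steinKernel θ S) := by
  unfold steinKernel; fun_prop

lemma hasDerivAt_gaussianPDFReal_one (θ x : ℝ) :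
    HasDerivAt (gaussianPDFReal θ 1) (-(x - θ) * gaussianPDFReal θ 1 x) x := by
  have h := ((((hasDerivAt_id x).sub_const θ).pow 2).neg.div_const (2 * ((1 : NNReal) : ℝ))).exp.const_mul
    (√(2 * Real.pi * ((1 : NNReal) : ℝ)))⁻¹
  rw [gaussianPDFReal_def]
  convert! h using 1
  simp
  ring

/-- An explicit antiderivative turns Stein's identity on each half-line into the fundamental theorem
of calculus, with visible boundary terms. -/
lemma hasDerivAt_stein (θ S x : ℝ) (h : x ^ 2 + S ≠ 0) :
    HasDerivAt (fun x ↦ -(x / (x ^ 2 + S)) * gaussianPDFReal θ 1 x)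
      (steinKernel θ S x * gaussianPDFReal θ 1 x) x := by
  have h1 : HasDerivAt (fun x : ℝ ↦ x ^ 2 + S) (2 * x) x := by
    simpa using (hasDerivAt_pow 2 x).add_const S
  have h2 := (((hasDerivAt_id x).div h1 h).neg).mul (hasDerivAt_gaussianPDFReal_one θ x)
  convert! h2 using 1
  simp only [steinKernel, id, Pi.neg_apply, Pi.div_apply]
  field_simp
  ring

lemma tendsto_gaussianPDFReal_cocompact (θ : ℝ) :
    Tendsto (gaussianPDFReal θ 1) (cocompact ℝ) (𝓝 0) := by
  have h1 : Tendsto (fun x : ℝ ↦ Real.exp (-x)) atTop (𝓝 0) := Real.tendsto_exp_neg_atTop_nhds_zero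
  have h2 : Tendsto (fun x : ℝ ↦ ‖x - θ‖ ^ 2 / 2) (cocompact ℝ) atTop := by
    have h3 : Tendsto (fun x : ℝ ↦ ‖x - θ‖) (cocompact ℝ) atTop := by
      simpa [dist_eq_norm] using tendsto_dist_right_cocompact_atTop θ
    exact ((tendsto_pow_atTop two_ne_zero).comp h3).atTop_div_const two_pos
  have h4 := (h1.comp h2).const_mul (√(2 * Real.pi * ((1 : NNReal) : ℝ)))⁻¹
  rw [mul_zero] at h4
  refine h4.congr fun x ↦ ?_
  simp [gaussianPDFReal, neg_div]

lemma tendsto_stein_zero (θ : ℝ) {c S r : ℝ} (hc : 0 < c) (hr : ∀ x, r ≤ |x| → c ≤ x ^ 2 + S)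
    (hS : 0 ≤ S) :
    Tendsto (fun x ↦ -(x / (x ^ 2 + S)) * gaussianPDFReal θ 1 x) (cocompact ℝ) (𝓝 0) := by
  have hlarge : ∀ᶠ x : ℝ in cocompact ℝ, r ≤ |x| :=
    (tendsto_norm_cocompact_atTop (E := ℝ)).eventually_ge_atTop r
  refine bdd_le_mul_tendsto_zero (b := -(1 + 1 / c)) (B := 1 + 1 / c) ?_ ?_
    (tendsto_gaussianPDFReal_cocompact θ) <;>
  · filter_upwards [hlarge] with x hx
    have hq := hr x hx
    have hq0 := hc.trans_le hq
    have h1 : (x ^ 2 + S) / c ≥ 1 := (one_le_div hc).2 hq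
    have h2 : |x / (x ^ 2 + S)| ≤ 1 + 1 / c := by
      -- The constant comes from `|x| ≤ x² + 1 ≤ (x² + S) + (x² + S) / c`.
      rw [abs_div, abs_of_pos hq0, div_le_iff₀ hq0, abs_le]
      have : (1 + 1 / c) * (x ^ 2 + S) = x ^ 2 + S + (x ^ 2 + S) / c := by ring
      rw [this]
      constructor <;> nlinarith [sq_nonneg (x + 1), sq_nonneg (x - 1)]
    have := abs_le.1 h2
    linarith [this.1, this.2]

/-- Stein's inequality for the truncation of `x / (x ^ 2 + S)` to `{c ≤ x ^ 2 + S}`: the jumps of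
the truncated function are nonnegative. -/
lemma integral_truncated_steinKernel_nonneg (θ : ℝ) {c S : ℝ} (hc : 0 < c) (hS : 0 ≤ S) :
    0 ≤ ∫ x, (if c ≤ x ^ 2 + S then steinKernel θ S x else 0) ∂gaussianReal θ 1 := by
  -- If `S ≥ c` the square root is `0` by convention; the region is then the whole line and the
  -- boundary terms vanish.
  set r : ℝ := √(c - S) with hrdef
  have hr0 : 0 ≤ r := Real.sqrt_nonneg _
  have hiff (x : ℝ) : c ≤ x ^ 2 + S ↔ r ≤ |x| := by
    rw [hrdef, Real.sqrt_le_left (abs_nonneg x), sq_abs, sub_le_iff_le_add]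
  have hset : {x : ℝ | c ≤ x ^ 2 + S} = Set.Iic (-r) ∪ Set.Ici r := by
    ext x
    simp only [Set.mem_ofPred_eq, hiff, le_abs, Set.mem_union, Set.mem_Iic, Set.mem_Ici]
    rw [or_comm, le_neg]
  have hms : MeasurableSet {x : ℝ | c ≤ x ^ 2 + S} := by
    rw [hset]; exact measurableSet_Iic.union measurableSet_Ici
  have hint : IntegrableOn (fun x ↦ steinKernel θ S x * gaussianPDFReal θ 1 x)
      {x : ℝ | c ≤ x ^ 2 + S} := by
    refine (integrable_gaussianPDFReal θ 1).integrableOn.bdd_mul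
      (c := 2 + θ ^ 2 / c + 3 / c) (measurable_steinKernel θ S).aestronglyMeasurable ?_
    filter_upwards [ae_restrict_mem hms] with x hx
    exact abs_steinKernel_le hc hS hx
  rw [integral_gaussianReal_eq_integral_smul one_ne_zero]
  have hind : (fun x ↦ gaussianPDFReal θ 1 x •
      (if c ≤ x ^ 2 + S then steinKernel θ S x else 0)) =
      {x : ℝ | c ≤ x ^ 2 + S}.indicator (fun x ↦ steinKernel θ S x * gaussianPDFReal θ 1 x) := by
    ext x
    simp only [Set.indicator_apply, Set.mem_ofPred_eq, smul_eq_mul]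
    split_ifs <;> ring
  rw [hind, integral_indicator hms]
  rw [hset] at hint ⊢
  -- For `r = 0` the two closed half-lines share a point; opening one of them makes the union
  -- disjoint at no cost in measure.
  have hae : (Set.Iic (-r) ∪ Set.Ici r : Set ℝ) =ᵐ[volume] (Set.Iic (-r) ∪ Set.Ioi r : Set ℝ) :=
    (EventuallyEq.refl _ _).union Ioi_ae_eq_Ici.symm
  have hdisj : Disjoint (Set.Iic (-r)) (Set.Ioi r) := by
    rw [Set.disjoint_left]
    intro x hx hx'
    simp only [Set.mem_Iic, Set.mem_Ioi] at hx hx'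
    linarith
  have hint1 := hint.mono_set (Set.subset_union_left (s := Set.Iic (-r)) (t := Set.Ici r))
  have hint2 := (hint.mono_set (Set.subset_union_right (s := Set.Iic (-r)) (t := Set.Ici r))).mono_set
    Set.Ioi_subset_Ici_self
  rw [setIntegral_congr_set hae, setIntegral_union hdisj measurableSet_Ioi hint1 hint2]
  have hlim := tendsto_stein_zero θ hc (fun x hx ↦ (hiff x).2 hx) hS
  rw [cocompact_eq_atBot_atTop, tendsto_sup] at hlim
  rw [integral_Iic_of_hasDerivAt_of_tendsto' (fun x hx ↦ hasDerivAt_stein θ S x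
      (hc.trans_le ((hiff x).2 ?_)).ne') hint1 hlim.1,
    integral_Ioi_of_hasDerivAt_of_tendsto' (fun x hx ↦ hasDerivAt_stein θ S x
      (hc.trans_le ((hiff x).2 ?_)).ne') hint2 hlim.2]
  · have hq : 0 < r ^ 2 + S := hc.trans_le ((hiff r).2 (le_abs_self r))
    have h1 : 0 ≤ r / (r ^ 2 + S) * gaussianPDFReal θ 1 (-r) :=
      mul_nonneg (div_nonneg hr0 hq.le) (gaussianPDFReal_nonneg _ _ _)
    have h2 : 0 ≤ r / (r ^ 2 + S) * gaussianPDFReal θ 1 r :=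
      mul_nonneg (div_nonneg hr0 hq.le) (gaussianPDFReal_nonneg _ _ _)
    have h3 : -(-r / ((-r) ^ 2 + S)) = r / (r ^ 2 + S) := by rw [neg_sq]; ring
    rw [h3]
    linarith
  · exact le_abs.2 (Or.inl hx)
  · exact le_abs.2 (Or.inr (le_neg.1 hx))

/-! ### Risk comparison in the canonical Gaussian model. -/

/-- The law of a Gaussian vector with mean `θ` and identity covariance matrix. -/
noncomputable def gaussianVec {p : ℕ} (θ : Fin p → ℝ) : Measure (Fin p → ℝ) :=
  Measure.pi fun i ↦ gaussianReal (θ i) 1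

instance {p : ℕ} (θ : Fin p → ℝ) : IsProbabilityMeasure (gaussianVec θ) := by
  unfold gaussianVec; infer_instance

/-- Truncated Stein integrand in coordinate `i`. -/
noncomputable def truncStein {p : ℕ} (c : ℝ) (θ : Fin p → ℝ) (i : Fin p) (v : Fin p → ℝ) : ℝ :=
  if c ≤ v ⬝ᵥ v then
    v i * (v i - θ i) / (v ⬝ᵥ v) - 1 / (v ⬝ᵥ v) + 2 * v i ^ 2 / (v ⬝ᵥ v) ^ 2 else 0

lemma measurable_dotProduct_self {p : ℕ} : Measurable fun v : Fin p → ℝ ↦ v ⬝ᵥ v := by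
  unfold dotProduct; fun_prop

lemma sq_le_dotProduct_self {p : ℕ} (v : Fin p → ℝ) (i : Fin p) : v i ^ 2 ≤ v ⬝ᵥ v := by
  simp only [dotProduct, ← sq]
  exact Finset.single_le_sum (f := fun j ↦ v j ^ 2) (fun _ _ ↦ sq_nonneg _) (Finset.mem_univ i)

lemma truncStein_eq {p : ℕ} (c : ℝ) (θ : Fin p → ℝ) (i : Fin p) (v : Fin p → ℝ) :
    truncStein c θ i v = if c ≤ v i ^ 2 + (v ⬝ᵥ v - v i ^ 2) then
      steinKernel (θ i) (v ⬝ᵥ v - v i ^ 2) (v i) else 0 := by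
  simp only [truncStein, steinKernel, add_sub_cancel]

lemma measurable_truncStein {p : ℕ} (c : ℝ) (θ : Fin p → ℝ) (i : Fin p) :
    Measurable (truncStein c θ i) := by
  have := measurable_dotProduct_self (p := p)
  refine Measurable.ite (measurableSet_le measurable_const this) ?_ measurable_const
  fun_prop

lemma integrable_truncStein {p : ℕ} {c : ℝ} (hc : 0 < c) (θ : Fin p → ℝ) (i : Fin p)
    (μ : Measure (Fin p → ℝ)) [IsFiniteMeasure μ] : Integrable (truncStein c θ i) μ := by
  refine Integrable.of_bound (measurable_truncStein c θ i).aestronglyMeasurable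
    (2 + θ i ^ 2 / c + 3 / c) (ae_of_all _ fun v ↦ ?_)
  rw [truncStein_eq]
  split_ifs with h
  · exact abs_steinKernel_le hc (sub_nonneg.2 (sq_le_dotProduct_self v i)) h
  · rw [norm_zero]; positivity

/-- With the other coordinates frozen, `S` is the sum of their squares and the one-variable
inequality applies on each fibre; Fubini then integrates over the fibres. -/
lemma integral_truncStein_nonneg {p : ℕ} {c : ℝ} (hc : 0 < c) (θ : Fin p → ℝ) (i : Fin p) :
    0 ≤ ∫ v, truncStein c θ i v ∂gaussianVec θ := by
  obtain _ | m := p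
  · exact i.elim0
  have hmp := measurePreserving_piFinSuccAbove (fun i ↦ gaussianReal (θ i) 1) i
  have hsymm := hmp.symm
  have hi : Integrable (fun z ↦ truncStein c θ i
      ((MeasurableEquiv.piFinSuccAbove (fun _ ↦ ℝ) i).symm z))
      ((gaussianReal (θ i) 1).prod (Measure.pi fun j ↦ gaussianReal (θ (i.succAbove j)) 1)) :=
    hsymm.integrable_comp_of_integrable (integrable_truncStein hc θ i _)
  rw [gaussianVec, ← hsymm.integral_comp (MeasurableEquiv.measurableEmbedding _),
    integral_prod_symm _ hi]
  refine integral_nonneg fun y ↦ ?_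
  have hS : 0 ≤ ∑ j, y j * y j := Finset.sum_nonneg fun j _ ↦ mul_self_nonneg _
  have hL (x : ℝ) : truncStein c θ i ((MeasurableEquiv.piFinSuccAbove (fun _ ↦ ℝ) i).symm (x, y)) =
      if c ≤ x ^ 2 + ∑ j, y j * y j then steinKernel (θ i) (∑ j, y j * y j) x else 0 := by
    have he : (MeasurableEquiv.piFinSuccAbove (fun _ ↦ ℝ) i).symm (x, y) = i.insertNth x y := rfl
    rw [truncStein_eq, he]
    simp [dotProduct, Fin.sum_univ_succAbove _ i, ← sq]
  simp_rw [hL]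
  exact integral_truncated_steinKernel_nonneg (θ i) hc hS

/-- Shrinkage factor of the preliminary test estimator in the canonical Gaussian limit. -/
noncomputable def ptFactor {p : ℕ} (c : ℝ) (v : Fin p → ℝ) : ℝ := if c ≤ v ⬝ᵥ v then 1 else 0

/-- Shrinkage factor of the improved preliminary test estimator in the canonical Gaussian limit. -/
noncomputable def iptFactor {p : ℕ} (c : ℝ) (v : Fin p → ℝ) : ℝ :=
  (1 - ((p : ℝ) - 2) * (v ⬝ᵥ v)⁻¹) * ptFactor c v

/-- Weighted quadratic loss of the estimate `κ v • v` of `θ`. -/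
noncomputable def shrinkLoss {p : ℕ} (l θ : Fin p → ℝ) (κ : (Fin p → ℝ) → ℝ) (v : Fin p → ℝ) : ℝ :=
  ∑ i, l i * (κ v * v i - θ i) ^ 2

lemma measurable_ptFactor {p : ℕ} (c : ℝ) : Measurable (ptFactor (p := p) c) :=
  Measurable.ite (measurableSet_le measurable_const measurable_dotProduct_self)
    measurable_const measurable_const

lemma abs_ptFactor_le {p : ℕ} (c : ℝ) (v : Fin p → ℝ) : |ptFactor c v| ≤ 1 := by
  unfold ptFactor; split_ifs <;> simp

lemma abs_iptFactor_le {p : ℕ} {c : ℝ} (hc : 0 < c) (v : Fin p → ℝ) :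
    |iptFactor c v| ≤ 1 + |(p : ℝ) - 2| * c⁻¹ := by
  unfold iptFactor ptFactor
  split_ifs with h
  · have hL : 0 < v ⬝ᵥ v := hc.trans_le h
    rw [mul_one]
    refine (abs_sub _ _).trans ?_
    rw [abs_one, abs_mul, abs_of_pos (inv_pos.2 hL)]
    gcongr
  · rw [mul_zero, abs_zero]; positivity

lemma integrable_shrinkLoss {p : ℕ} (l θ : Fin p → ℝ) {κ : (Fin p → ℝ) → ℝ} (hκ : Measurable κ)
    {B : ℝ} (hB : ∀ v, |κ v| ≤ B) : Integrable (shrinkLoss l θ κ) (gaussianVec θ) := by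
  refine integrable_finsetSum _ fun i _ ↦ Integrable.const_mul ?_ _
  have hv : MemLp (fun v : Fin p → ℝ ↦ v i) 2 (gaussianVec θ) :=
    (memLp_id_gaussianReal' 2 (by simp)).comp_measurePreserving
      (measurePreserving_eval (fun i ↦ gaussianReal (θ i) 1) i)
  have hm : MemLp (fun v : Fin p → ℝ ↦ κ v * v i) 2 (gaussianVec θ) := by
    refine hv.of_le_mul (c := B) (by fun_prop) (ae_of_all _ fun v ↦ ?_)
    rw [norm_mul]
    exact mul_le_mul_of_nonneg_right (hB v) (norm_nonneg _)
  exact (hm.sub (memLp_const (θ i))).integrable_sq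

/-- Pointwise part of the loss reduction that remains after Stein's inequality. -/
noncomputable def lossGap {p : ℕ} (c : ℝ) (k : Fin p → ℝ) (v : Fin p → ℝ) : ℝ :=
  ∑ i, k i * (if c ≤ v ⬝ᵥ v then v i ^ 2 / (v ⬝ᵥ v) ^ 2 else 0)

lemma integrable_lossGap {p : ℕ} {c : ℝ} (hc : 0 < c) (k : Fin p → ℝ)
    (μ : Measure (Fin p → ℝ)) [IsFiniteMeasure μ] : Integrable (lossGap c k) μ := by
  refine integrable_finsetSum _ fun i _ ↦ Integrable.const_mul ?_ _
  refine Integrable.of_bound (Measurable.aestronglyMeasurable ?_) (1 / c) (ae_of_all _ fun v ↦ ?_)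
  · have := measurable_dotProduct_self (p := p)
    exact Measurable.ite (measurableSet_le measurable_const this) (by fun_prop) measurable_const
  · split_ifs with h
    · have hL : 0 < v ⬝ᵥ v := hc.trans_le h
      rw [Real.norm_of_nonneg (by positivity), div_le_div_iff₀ (by positivity) hc, one_mul, sq (v ⬝ᵥ v)]
      exact mul_le_mul (sq_le_dotProduct_self v i) h hc.le hL.le
    · rw [norm_zero]; positivity

lemma integral_lossGap_pos {p : ℕ} (c : ℝ) {k : Fin p → ℝ} (hk : ∀ i, 0 ≤ k i)
    {j : Fin p} (hj : 0 < k j) (hc : 0 < c) (θ : Fin p → ℝ) :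
    0 < ∫ v, lossGap c k v ∂gaussianVec θ := by
  have hterm (v : Fin p → ℝ) (i : Fin p) :
      0 ≤ k i * (if c ≤ v ⬝ᵥ v then v i ^ 2 / (v ⬝ᵥ v) ^ 2 else 0) :=
    mul_nonneg (hk i) (by split_ifs <;> positivity)
  have hnn : 0 ≤ lossGap c k := fun v ↦ Finset.sum_nonneg fun i _ ↦ hterm v i
  rw [integral_pos_iff_support_of_nonneg hnn (integrable_lossGap hc k _)]
  -- On `v j > √c` the vector passes the threshold and the `j`-th term is positive, so positive mass
  -- of this half-space suffices.
  have hpos : 0 < gaussianReal (θ j) 1 (Set.Ioi (√c)) := by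
    refine pos_iff_ne_zero.2 fun h0 ↦ ?_
    have := gaussianReal_absolutelyContinuous' (θ j) one_ne_zero h0
    simp at this
  rw [← (measurePreserving_eval (fun i ↦ gaussianReal (θ i) 1) j).measure_preimage
    measurableSet_Ioi.nullMeasurableSet] at hpos
  refine hpos.trans_le (measure_mono fun v hv ↦ ?_)
  have hv' : √c < v j := hv
  have hvc : c ≤ v j ^ 2 := by
    rw [← Real.sq_sqrt hc.le]
    exact pow_le_pow_left₀ (Real.sqrt_nonneg c) hv'.le 2
  have hL := hvc.trans (sq_le_dotProduct_self v j)
  have hL0 := hc.trans_le hL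
  have hvj : 0 < v j ^ 2 := hc.trans_le hvc
  rw [Function.mem_support]
  refine (Finset.sum_pos' (fun i _ ↦ hterm v i) ⟨j, Finset.mem_univ j, ?_⟩).ne'
  rw [if_pos hL]
  positivity

/-- The loss is split so that Stein's inequality controls one part and the trace condition the
other. The terms `lᵢ / L` subtracted inside `truncStein` reappear in `lossGap`, where `∑ vᵢ² = L`
rewrites `∑ lᵢ / L` as `(∑ l) ∑ vᵢ² / L²`. -/
lemma shrinkLoss_iptFactor {p : ℕ} {c : ℝ} (hc : 0 < c) (l θ v : Fin p → ℝ) :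
    shrinkLoss l θ (iptFactor c) v = shrinkLoss l θ (ptFactor c) v
      - 2 * ((p : ℝ) - 2) * ∑ i, l i * truncStein c θ i v
      - ((p : ℝ) - 2) * lossGap c (fun i ↦ 2 * ∑ j, l j - ((p : ℝ) + 2) * l i) v := by
  unfold shrinkLoss iptFactor ptFactor truncStein lossGap
  split_ifs with h
  · have hL := (hc.trans_le h).ne'
    have hsum : ∑ i, (2 * ∑ j, l j - ((p : ℝ) + 2) * l i) * (v i ^ 2 / (v ⬝ᵥ v) ^ 2) =
        ∑ i, l i * (2 / (v ⬝ᵥ v) - ((p : ℝ) + 2) * (v i ^ 2 / (v ⬝ᵥ v) ^ 2)) := by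
      have h1 : ∑ i, v i ^ 2 = v ⬝ᵥ v := by simp [dotProduct, sq]
      simp only [sub_mul, mul_sub, Finset.sum_sub_distrib]
      congr 1
      · rw [← Finset.mul_sum, ← Finset.sum_div, h1, ← Finset.sum_mul]
        field_simp
      · exact Finset.sum_congr rfl fun i _ ↦ by ring
    rw [hsum, Finset.mul_sum, Finset.mul_sum, ← Finset.sum_sub_distrib, ← Finset.sum_sub_distrib]
    refine Finset.sum_congr rfl fun i _ ↦ ?_
    field_simp
    ring
  · simp

/-- The improved preliminary test estimator has strictly smaller weighted risk in the canonical
Gaussian model. -/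
theorem integral_shrinkLoss_iptFactor_lt {p : ℕ} (hp : 3 ≤ p) {c : ℝ} (hc : 0 < c)
    {l : Fin p → ℝ} (hl : ∀ i, 0 < l i) (htr : ∀ i, ((p : ℝ) + 2) * l i ≤ 2 * ∑ j, l j)
    (θ : Fin p → ℝ) :
    ∫ v, shrinkLoss l θ (iptFactor c) v ∂gaussianVec θ <
      ∫ v, shrinkLoss l θ (ptFactor c) v ∂gaussianVec θ := by
  have hp' : (3 : ℝ) ≤ p := by exact_mod_cast hp
  have hne : Nonempty (Fin p) := ⟨⟨0, by omega⟩⟩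
  have hsum : 0 < ∑ j, l j := Finset.sum_pos (fun i _ ↦ hl i) Finset.univ_nonempty
  -- The coefficients add up to `(p - 2) ∑ l > 0`, so one of them is positive.
  obtain ⟨j, -, hj⟩ : ∃ j ∈ Finset.univ, 0 < 2 * ∑ j, l j - ((p : ℝ) + 2) * l j := by
    refine Finset.exists_lt_of_sum_lt (f := fun _ ↦ (0 : ℝ)) ?_
    rw [Finset.sum_sub_distrib, ← Finset.mul_sum, ← Finset.mul_sum]
    simp only [Finset.sum_const_zero, Finset.sum_const, Finset.card_univ, Fintype.card_fin,
      nsmul_eq_mul]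
    nlinarith
  have hgap := integral_lossGap_pos c (fun i ↦ sub_nonneg.2 (htr i)) hj hc θ
  have hst : 0 ≤ ∫ v, ∑ i, l i * truncStein c θ i v ∂gaussianVec θ := by
    rw [integral_finsetSum _ fun i _ ↦ (integrable_truncStein hc θ i _).const_mul _]
    refine Finset.sum_nonneg fun i _ ↦ ?_
    rw [integral_const_mul]
    exact mul_nonneg (hl i).le (integral_truncStein_nonneg hc θ i)
  have hi1 := integrable_shrinkLoss l θ (measurable_ptFactor c) (abs_ptFactor_le c)
  have hi2 : Integrable (fun v ↦ ∑ i, l i * truncStein c θ i v) (gaussianVec θ) :=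
    integrable_finsetSum _ fun i _ ↦ (integrable_truncStein hc θ i _).const_mul _
  have hi3 := integrable_lossGap hc (fun i ↦ 2 * ∑ j, l j - ((p : ℝ) + 2) * l i) (gaussianVec θ)
  simp_rw [shrinkLoss_iptFactor hc l θ]
  rw [integral_sub (f := fun v ↦ shrinkLoss l θ (ptFactor c) v -
      2 * ((p : ℝ) - 2) * ∑ i, l i * truncStein c θ i v)
      (hi1.sub (hi2.const_mul _)) (hi3.const_mul _), integral_sub hi1 (hi2.const_mul _), integral_const_mul, integral_const_mul]
  have h1 := mul_pos (show (0 : ℝ) < p - 2 by linarith) hgap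
  have h2 := mul_nonneg (show (0 : ℝ) ≤ 2 * (p - 2) by linarith) hst
  linarith

/-- Given the other coordinates, at most two values of the first one lie on the sphere, and a
nondegenerate Gaussian has no atoms. -/
lemma gaussianVec_dotProduct_self_eq {p : ℕ} {c : ℝ} (hc : 0 < c) (θ : Fin p → ℝ) :
    gaussianVec θ {v | v ⬝ᵥ v = c} = 0 := by
  obtain _ | m := p
  · have : {v : Fin 0 → ℝ | v ⬝ᵥ v = c} = ∅ := by
      ext v; simp [dotProduct, hc.ne]
    rw [this, measure_empty]
  have hms : MeasurableSet {v : Fin (m + 1) → ℝ | v ⬝ᵥ v = c} :=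
    measurableSet_eq_fun measurable_dotProduct_self measurable_const
  have hsymm := (measurePreserving_piFinSuccAbove (fun i ↦ gaussianReal (θ i) 1) 0).symm
  have hatom := nullSingletonClass_gaussianReal (μ := θ 0) (one_ne_zero (α := NNReal))
  rw [gaussianVec, ← hsymm.measure_preimage hms.nullMeasurableSet,
    Measure.prod_apply_symm (hsymm.measurable hms)]
  refine (lintegral_congr fun y ↦ ?_).trans lintegral_zero
  refine measure_mono_null (t := {√(c - ∑ j, y j * y j), -√(c - ∑ j, y j * y j)}) (fun x hx ↦ ?_)
    ((Set.toFinite _).measure_zero (gaussianReal (θ 0) 1))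
  have hx' : (Fin.insertNth 0 x y : Fin (m + 1) → ℝ) ⬝ᵥ Fin.insertNth 0 x y = c := hx
  have hsq : c - ∑ j, y j * y j = x ^ 2 := by
    rw [← hx']
    simp [dotProduct, Fin.sum_univ_succ, ← sq]
  rw [hsq, Real.sqrt_sq_eq_abs]
  rcases abs_choice x with h | h <;> simp [h]

/-! ### Central limit theorem for weighted sums, through characteristic functions. -/

lemma norm_prod_sub_prod_le {ι : Type*} (s : Finset ι) (f g : ι → ℂ)
    (hf : ∀ i ∈ s, ‖f i‖ ≤ 1) (hg : ∀ i ∈ s, ‖g i‖ ≤ 1) :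
    ‖∏ i ∈ s, f i - ∏ i ∈ s, g i‖ ≤ ∑ i ∈ s, ‖f i - g i‖ := by
  classical
  induction s using Finset.induction_on with
  | empty => simp
  | insert i s hi ih =>
    rw [Finset.prod_insert hi, Finset.prod_insert hi, Finset.sum_insert hi]
    have ih' := ih (fun j hj ↦ hf j (Finset.mem_insert_of_mem hj))
      (fun j hj ↦ hg j (Finset.mem_insert_of_mem hj))
    have hfi := hf i (Finset.mem_insert_self i s)
    have hprod : ‖∏ j ∈ s, g j‖ ≤ 1 := by
      rw [norm_prod]
      exact Finset.prod_le_one (fun _ _ ↦ norm_nonneg _)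
        fun j hj ↦ hg j (Finset.mem_insert_of_mem hj)
    calc ‖f i * ∏ j ∈ s, f j - g i * ∏ j ∈ s, g j‖
        = ‖(f i - g i) * ∏ j ∈ s, g j + f i * (∏ j ∈ s, f j - ∏ j ∈ s, g j)‖ := by ring_nf
      _ ≤ ‖f i - g i‖ * ‖∏ j ∈ s, g j‖ + ‖f i‖ * ‖∏ j ∈ s, f j - ∏ j ∈ s, g j‖ := by
        grw [norm_add_le, norm_mul, norm_mul]
      _ ≤ ‖f i - g i‖ * 1 + 1 * ∑ j ∈ s, ‖f j - g j‖ := by gcongr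
      _ = _ := by ring

lemma isLittleO_exp_neg_sq_div_two :
    (fun t : ℝ ↦ Complex.exp (-(t : ℂ) ^ 2 / 2) - (1 - (t : ℂ) ^ 2 / 2)) =o[𝓝 0]
      fun t ↦ t ^ 2 := by
  have h1 := (Complex.hasDerivAt_exp 0).isLittleO
  have h2 : Tendsto (fun t : ℝ ↦ -(t : ℂ) ^ 2 / 2) (𝓝 0) (𝓝 0) := by
    have : Continuous fun t : ℝ ↦ -(t : ℂ) ^ 2 / 2 := by fun_prop
    simpa using this.tendsto 0
  have h3 := h1.comp_tendsto h2
  refine (h3.congr_left fun t ↦ ?_).trans_isBigO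
    (Asymptotics.IsBigO.of_bound 1 (Eventually.of_forall fun t ↦ ?_))
  · simp
    ring
  · simp only [Function.comp_apply, sub_zero, norm_div, norm_neg, norm_pow, Complex.norm_real,
      RCLike.norm_ofNat, one_mul]
    linarith [sq_nonneg ‖t‖]

/-- Products of a characteristic function with standardized second-order expansion along a
uniformly negligible triangular array. -/
lemma tendsto_prod_of_isLittleO {φ : ℝ → ℂ} (hφ : ∀ t, ‖φ t‖ ≤ 1)
    (hφ2 : (fun t : ℝ ↦ φ t - (1 - (t : ℂ) ^ 2 / 2)) =o[𝓝 0] fun t ↦ t ^ 2)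
    {a : ∀ n : ℕ, Fin n → ℝ} {τ : ℝ} (hsum : Tendsto (fun n ↦ ∑ j, a n j ^ 2) atTop (𝓝 τ))
    (hmax : ∀ η > 0, ∀ᶠ n in atTop, ∀ j, |a n j| < η) :
    Tendsto (fun n ↦ ∏ j, φ (a n j)) atTop (𝓝 (Complex.exp (-(τ : ℂ) / 2))) := by
  have hψ (t : ℝ) : ‖Complex.exp (-(t : ℂ) ^ 2 / 2)‖ ≤ 1 := by
    rw [show -(t : ℂ) ^ 2 / 2 = ((-t ^ 2 / 2 : ℝ) : ℂ) by push_cast; ring, Complex.norm_exp,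
      Complex.ofReal_re, Real.exp_le_one_iff]
    linarith [sq_nonneg t]
  have hdiff : (fun t : ℝ ↦ φ t - Complex.exp (-(t : ℂ) ^ 2 / 2)) =o[𝓝 0] fun t ↦ t ^ 2 :=
    (hφ2.sub isLittleO_exp_neg_sq_div_two).congr_left fun t ↦ by ring
  have hlim : Tendsto (fun n ↦ ∏ j, Complex.exp (-(a n j : ℂ) ^ 2 / 2)) atTop
      (𝓝 (Complex.exp (-(τ : ℂ) / 2))) := by
    have h1 : Tendsto (fun n ↦ Complex.exp (-((∑ j, a n j ^ 2 : ℝ) : ℂ) / 2)) atTop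
        (𝓝 (Complex.exp (-(τ : ℂ) / 2))) := by
      have hc : Continuous fun x : ℝ ↦ Complex.exp (-(x : ℂ) / 2) := by fun_prop
      exact (hc.tendsto τ).comp hsum
    refine h1.congr fun n ↦ ?_
    rw [← Complex.exp_sum]
    congr 1
    push_cast
    rw [← Finset.sum_neg_distrib, Finset.sum_div]
  suffices h0 : Tendsto (fun n ↦ ∏ j, φ (a n j) - ∏ j, Complex.exp (-(a n j : ℂ) ^ 2 / 2)) atTop
      (𝓝 0) by simpa using h0.add hlim
  rw [Metric.tendsto_nhds]
  intro ε hε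
  have hτ : 0 ≤ τ := ge_of_tendsto' hsum fun n ↦ Finset.sum_nonneg fun _ _ ↦ sq_nonneg _
  -- The squares eventually sum to less than `τ + 1`, so this constant yields a total error of at
  -- most `ε / 2`; the `+ 1` also covers `τ = 0`.
  obtain ⟨η, hη, hball⟩ := Metric.eventually_nhds_iff.1
    (hdiff.def (show 0 < ε / (2 * (τ + 1)) by positivity))
  filter_upwards [hmax η hη, hsum.eventually_lt_const (lt_add_one τ)] with n hn hn2
  rw [dist_zero_right]
  refine (norm_prod_sub_prod_le _ _ _ (fun _ _ ↦ hφ _) (fun _ _ ↦ hψ _)).trans_lt ?_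
  calc ∑ j, ‖φ (a n j) - Complex.exp (-(a n j : ℂ) ^ 2 / 2)‖
      ≤ ∑ j, ε / (2 * (τ + 1)) * a n j ^ 2 := by
        refine Finset.sum_le_sum fun j _ ↦ ?_
        have := hball (y := a n j) (by simpa using hn j)
        rwa [norm_pow, Real.norm_eq_abs, sq_abs] at this
    _ = ε / (2 * (τ + 1)) * ∑ j, a n j ^ 2 := by rw [Finset.mul_sum]
    _ ≤ ε / (2 * (τ + 1)) * (τ + 1) := by gcongr
    _ = ε / 2 := by field_simp
    _ < ε := by linarith

lemma charFun_map_weighted_sum {Ω : Type*} [MeasurableSpace Ω] {P : Measure Ω} {u : ℕ → Ω → ℝ} (hindep : iIndepFun u P)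
    (hident : ∀ i, IdentDistrib (u i) (u 0) P P) {n : ℕ} (a : Fin n → ℝ) :
    charFun (P.map fun ω ↦ ∑ j : Fin n, a j * u j ω) 1 = ∏ j, charFun (P.map (u 0)) (a j) := by
  have hm (i : ℕ) := (hident i).aemeasurable_fst
  have hind : iIndepFun (fun (j : Fin n) ω ↦ a j * u j ω) P :=
    (hindep.precomp (g := ((↑) : Fin n → ℕ)) Fin.val_injective).comp (fun j x ↦ a j * x)
      fun j ↦ by fun_prop
  rw [iIndepFun.charFun_map_fun_sum_eq_prod (fun j : Fin n ↦ (hm j).const_mul (a j)) hind,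
    Finset.prod_apply]
  refine Finset.prod_congr rfl fun j _ ↦ ?_
  rw [charFun_map_mul_comp (hm j), (hident j).map_eq, mul_one]

lemma charFun_gaussianVec_map {p : ℕ} (D : Matrix (Fin p) (Fin p) ℝ) (θ : Fin p → ℝ)
    (t : EuclideanSpace ℝ (Fin p)) :
    charFun ((gaussianVec θ).map fun v ↦ WithLp.toLp 2 (D *ᵥ v)) t =
      Complex.exp (((t.ofLp ⬝ᵥ (D *ᵥ θ) : ℝ) : ℂ) * Complex.I) *
        Complex.exp (-((t.ofLp ⬝ᵥ ((D * Dᵀ) *ᵥ t.ofLp) : ℝ) : ℂ) / 2) := by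
  have h1 : charFun ((gaussianVec θ).map fun v ↦ WithLp.toLp 2 (D *ᵥ v)) t =
      charFun ((gaussianVec θ).map (WithLp.toLp 2)) (WithLp.toLp 2 (t.ofLp ᵥ* D)) := by
    rw [charFun_apply, charFun_apply, integral_map (by fun_prop) (by fun_prop),
      integral_map (by fun_prop) (by fun_prop)]
    refine integral_congr_ae (ae_of_all _ fun v ↦ ?_)
    simp only [EuclideanSpace.inner_eq_star_dotProduct, star_trivial]
    rw [dotProduct_mulVec]
  have h2 : t.ofLp ⬝ᵥ ((D * Dᵀ) *ᵥ t.ofLp) = (t.ofLp ᵥ* D) ⬝ᵥ (t.ofLp ᵥ* D) := by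
    rw [← mulVec_mulVec, dotProduct_mulVec, mulVec_transpose]
  rw [h1, gaussianVec, charFun_pi, dotProduct_mulVec, h2]
  simp only [charFun_gaussianReal, ← Complex.exp_sum, ← Complex.exp_add]
  congr 1
  simp only [dotProduct, Complex.ofReal_sum, Complex.ofReal_mul, Finset.sum_mul,
    Finset.sum_sub_distrib, ← Finset.sum_div]
  simp [sq, sub_eq_add_neg, neg_div]

variable {Ω : Type*} [MeasurableSpace Ω] {P : Measure Ω} [IsProbabilityMeasure P]

/-- Central limit theorem for linear transforms `D θ + B n (u 0, …, u (n - 1))` of standardized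
i.i.d. errors with uniformly negligible coefficients. -/
theorem tendstoInDistribution_linear {u : ℕ → Ω → ℝ} (hindep : iIndepFun u P)
    (hident : ∀ i, IdentDistrib (u i) (u 0) P P) (h0 : P[u 0] = 0) (h1 : P[u 0 ^ 2] = 1)
    {p : ℕ} {B : ∀ n : ℕ, Matrix (Fin p) (Fin n) ℝ} {D : Matrix (Fin p) (Fin p) ℝ}
    (hB : Tendsto (fun n ↦ B n * (B n)ᵀ) atTop (𝓝 (D * Dᵀ)))
    (hmax : ∀ t : Fin p → ℝ, ∀ η > 0, ∀ᶠ n in atTop, ∀ j, |(t ᵥ* B n) j| < η)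
    (θ : Fin p → ℝ) :
    TendstoInDistribution (fun (n : ℕ) ω ↦ D *ᵥ θ + B n *ᵥ fun j : Fin n ↦ u j ω) atTop
      (fun v ↦ D *ᵥ v) (fun _ ↦ P) (gaussianVec θ) := by
  have hm (i : ℕ) := (hident i).aemeasurable_fst
  have hW (n : ℕ) : AEMeasurable (fun ω ↦ D *ᵥ θ + B n *ᵥ fun j : Fin n ↦ u j ω) P := by
    have h1 : Measurable fun y : Fin n → ℝ ↦ D *ᵥ θ + B n *ᵥ y :=
      Continuous.measurable (by fun_prop)
    exact h1.comp_aemeasurable (aemeasurable_pi_lambda _ fun j ↦ hm j)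
  have hWE (n : ℕ) : AEMeasurable (fun ω ↦ (WithLp.toLp 2
      (D *ᵥ θ + B n *ᵥ fun j : Fin n ↦ u j ω) : EuclideanSpace ℝ (Fin p))) P :=
    (by fun_prop : Measurable (WithLp.toLp 2 : (Fin p → ℝ) →
      EuclideanSpace ℝ (Fin p))).comp_aemeasurable (hW n)
  -- Lévy's continuity theorem needs an inner product, so convergence is proved in `EuclideanSpace`
  -- and carried back by continuity of `WithLp.ofLp`.
  have hE : TendstoInDistribution
      (fun (n : ℕ) ω ↦ WithLp.toLp 2 (D *ᵥ θ + B n *ᵥ fun j : Fin n ↦ u j ω)) atTop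
      (fun v ↦ WithLp.toLp 2 (D *ᵥ v)) (fun _ ↦ P) (gaussianVec θ) := by
    refine ⟨hWE, by fun_prop, ?_⟩
    refine ProbabilityMeasure.tendsto_iff_tendsto_charFun.2 fun t ↦ ?_
    have hlim := (tendsto_prod_of_isLittleO (φ := charFun (P.map (u 0))) (τ :=
      t.ofLp ⬝ᵥ ((D * Dᵀ) *ᵥ t.ofLp)) (a := fun n ↦ t.ofLp ᵥ* B n)
      (fun s ↦ ?_) ?_ ?_ (hmax t.ofLp)).const_mul
      (Complex.exp (((t.ofLp ⬝ᵥ (D *ᵥ θ) : ℝ) : ℂ) * Complex.I))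
    · simp only [ProbabilityMeasure.coe_mk]
      rw [charFun_gaussianVec_map]
      refine hlim.congr fun n ↦ ?_
      rw [← charFun_map_weighted_sum hindep hident, charFun_apply, charFun_apply,
        integral_map (Finset.aemeasurable_fun_sum Finset.univ fun (j : Fin n) _ ↦
          (hm j).const_mul ((t.ofLp ᵥ* B n) j)) (by fun_prop),
        integral_map (hWE n) (by fun_prop),
        ← integral_const_mul]
      refine integral_congr_ae (ae_of_all _ fun ω ↦ ?_)
      simp only [EuclideanSpace.inner_eq_star_dotProduct, star_trivial, dotProduct_add]
      rw [dotProduct_mulVec t.ofLp (B n), Complex.ofReal_add, add_mul, Complex.exp_add]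
      simp [dotProduct]
    · have := Measure.isProbabilityMeasure_map (hm 0)
      exact norm_charFun_le_one s
    · exact taylor_charFun_two (hm 0) h0 h1
    · have hc : Continuous fun M : Matrix (Fin p) (Fin p) ℝ ↦ t.ofLp ⬝ᵥ (M *ᵥ t.ofLp) := by
        fun_prop
      refine ((hc.tendsto _).comp hB).congr fun n ↦ ?_
      simp only [Function.comp_apply]
      rw [← mulVec_mulVec, dotProduct_mulVec, mulVec_transpose]
      simp [dotProduct, sq]
  exact hE.continuous_comp (g := WithLp.ofLp) (by fun_prop)

/-! ### Continuous mapping for almost everywhere continuous maps. -/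

/-- **Continuous mapping theorem** for maps that are continuous at almost every point of the
limit. -/
theorem tendstoInDistribution_comp_of_ae_continuousAt {E F Ω' : Type*} [TopologicalSpace E]
    [HasOuterApproxClosed E] [MeasurableSpace E] [OpensMeasurableSpace E]
    [TopologicalSpace F] [MeasurableSpace F] [OpensMeasurableSpace F]
    [MeasurableSpace Ω'] {Q : Measure Ω'} [IsProbabilityMeasure Q]
    {X : ℕ → Ω → E} {Z : Ω' → E} {g : E → F} (hg : Measurable g)
    (h : TendstoInDistribution X atTop Z (fun _ ↦ P) Q)
    (hc : ∀ᵐ ω ∂Q, ContinuousAt g (Z ω)) :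
    TendstoInDistribution (fun n ω ↦ g (X n ω)) atTop (fun ω ↦ g (Z ω)) (fun _ ↦ P) Q where
  forall_aemeasurable n := hg.comp_aemeasurable (h.forall_aemeasurable n)
  aemeasurable_limit := hg.comp_aemeasurable h.aemeasurable_limit
  tendsto := by
    refine tendsto_of_forall_isClosed_limsup_le' fun S hS ↦ ?_
    have hlim := ProbabilityMeasure.limsup_measure_closed_le_of_tendsto h.tendsto
      (isClosed_closure (s := g ⁻¹' S))
    simp only [ProbabilityMeasure.coe_mk] at hlim ⊢
    have hSm := hS.measurableSet
    calc limsup (fun n ↦ P.map (fun ω ↦ g (X n ω)) S) atTop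
        ≤ limsup (fun n ↦ P.map (X n) (closure (g ⁻¹' S))) atTop := by
          refine limsup_le_limsup (Eventually.of_forall fun n ↦ ?_)
          have hm : AEMeasurable (fun ω ↦ g (X n ω)) P :=
            hg.comp_aemeasurable (h.forall_aemeasurable n)
          simp only
          rw [Measure.map_apply_of_aemeasurable hm hSm,
            Measure.map_apply_of_aemeasurable (h.forall_aemeasurable n) isClosed_closure.measurableSet]
          exact measure_mono fun ω hω ↦ subset_closure hω
      _ ≤ Q.map Z (closure (g ⁻¹' S)) := hlim
      _ ≤ Q.map (fun ω ↦ g (Z ω)) S := by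
          have hm : AEMeasurable (fun ω ↦ g (Z ω)) Q := hg.comp_aemeasurable h.aemeasurable_limit
          rw [Measure.map_apply_of_aemeasurable hm hSm,
            Measure.map_apply_of_aemeasurable h.aemeasurable_limit isClosed_closure.measurableSet]
          -- At a continuity point of `g`, membership in the closure of `g ⁻¹' S` forces the image
          -- into the closed set `S`.
          refine measure_mono_ae ?_
          filter_upwards [hc] with ω hω hmem
          exact hS.closure_subset_iff.2 (Set.image_preimage_subset g S)
            (hω.continuousWithinAt.mem_closure_image hmem)

/-! ### Simultaneous diagonalization of `C` and of the loss. -/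

/-- The choice `A = U diag(√l)`, rather than the symmetric square root of `C⁻¹`, whitens `C` and at
the same time makes the quadratic loss diagonal. -/
lemma exists_diagonalizing_sqrt_inv {p : ℕ} {C : Matrix (Fin p) (Fin p) ℝ} (hC : C.PosDef) :
    ∃ (A : Matrix (Fin p) (Fin p) ℝ) (l : Fin p → ℝ), A * Aᵀ = C⁻¹ ∧ Aᵀ * A = diagonal l ∧
      Aᵀ * C * A = 1 ∧ (∀ i, 0 < l i) ∧ (∀ i, l i ≤ chMax C⁻¹) ∧ ∑ i, l i = trace C⁻¹ := by
  have hCi := hC.inv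
  have hH := hCi.isHermitian
  set l := hH.eigenvalues with hl
  set U : Matrix (Fin p) (Fin p) ℝ := hH.eigenvectorUnitary.1 with hU
  have hlpos (i) : 0 < l i := hCi.eigenvalues_pos i
  have hUU : Uᵀ * U = 1 := by
    have := Unitary.coe_star_mul_self hH.eigenvectorUnitary
    rwa [star_eq_conjTranspose, conjTranspose_eq_transpose_of_trivial] at this
  have hspec : C⁻¹ = U * diagonal l * Uᵀ := by
    have h := hH.spectral_theorem
    rw [Unitary.conjStarAlgAut_apply] at h
    simpa [star_eq_conjTranspose, conjTranspose_eq_transpose_of_trivial, Function.comp_def] using h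
  have hsq : diagonal (fun i ↦ √(l i)) * diagonal (fun i ↦ √(l i)) = diagonal l := by
    rw [diagonal_mul_diagonal]
    congr 1
    ext i
    exact Real.mul_self_sqrt (hlpos i).le
  have hAA : (U * diagonal fun i ↦ √(l i)) * (U * diagonal fun i ↦ √(l i))ᵀ = C⁻¹ := by
    rw [transpose_mul, diagonal_transpose, hspec, ← hsq]
    simp only [Matrix.mul_assoc]
  refine ⟨U * diagonal fun i ↦ √(l i), l, hAA, ?_, ?_, hlpos, fun i ↦ ?_, ?_⟩
  · rw [transpose_mul, diagonal_transpose, ← hsq, Matrix.mul_assoc, ← Matrix.mul_assoc Uᵀ, hUU,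
      Matrix.one_mul]
  · rw [mul_eq_one_comm, ← Matrix.mul_assoc, hAA]
    exact nonsing_inv_mul _ ((isUnit_iff_isUnit_det _).1 hC.isUnit)
  · refine le_csSup ?_ (hH.eigenvalues_mem_spectrum_real i)
    rw [hH.spectrum_real_eq_range_eigenvalues]
    exact (Set.finite_range _).bddAbove
  · simpa using hH.trace_eq_sum_eigenvalues.symm

/-! ### Exact algebra of least squares for a fixed design. -/

section Design

variable {n p : ℕ} {X : Matrix (Fin n) (Fin p) ℝ}

lemma lse_eq_add (hX : IsUnit (Xᵀ * X).det) (b : Fin p → ℝ) (e : Fin n → ℝ) :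
    lse X (X *ᵥ b + e) = b + (Xᵀ * X)⁻¹ *ᵥ (Xᵀ *ᵥ e) := by
  rw [lse, mulVec_add, mulVec_add, mulVec_mulVec, mulVec_mulVec, Matrix.mul_assoc,
    nonsing_inv_mul _ hX, one_mulVec]

/-- Pythagoras: the residual is the part of `e` orthogonal to the column space of `X`, so `b` drops
out. -/
lemma residVar_eq (hX : IsUnit (Xᵀ * X).det) (b : Fin p → ℝ) (e : Fin n → ℝ) :
    residVar X (X *ᵥ b + e) = ((n : ℝ) - p)⁻¹ * (e ⬝ᵥ e -
      ((Xᵀ * X)⁻¹ *ᵥ (Xᵀ *ᵥ e)) ⬝ᵥ ((Xᵀ * X) *ᵥ ((Xᵀ * X)⁻¹ *ᵥ (Xᵀ *ᵥ e)))) := by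
  rw [residVar, lse_eq_add hX]
  set h := (Xᵀ * X)⁻¹ *ᵥ (Xᵀ *ᵥ e) with hh
  have h1 : X *ᵥ b + e - X *ᵥ (b + h) = e - X *ᵥ h := by
    rw [mulVec_add]; abel
  have h2 : (Xᵀ * X) *ᵥ h = Xᵀ *ᵥ e := by
    rw [hh, mulVec_mulVec, mul_nonsing_inv _ hX, one_mulVec]
  have h3 : h ⬝ᵥ (Xᵀ *ᵥ e) = e ⬝ᵥ (X *ᵥ h) := by
    rw [dotProduct_mulVec, vecMul_transpose, dotProduct_comm]
  have h4 : (X *ᵥ h) ⬝ᵥ (X *ᵥ h) = e ⬝ᵥ (X *ᵥ h) := by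
    rw [← h3, ← h2, ← mulVec_mulVec, dotProduct_mulVec h, vecMul_transpose]
  rw [h1, h2, h3, sub_dotProduct, dotProduct_sub, dotProduct_sub, h4, dotProduct_comm (X *ᵥ h) e]
  ring

lemma continuous_lse (X : Matrix (Fin n) (Fin p) ℝ) : Continuous (lse X) := by
  unfold lse; fun_prop

lemma measurable_testStat (X : Matrix (Fin n) (Fin p) ℝ) : Measurable (testStat X) := by
  have h := continuous_lse X
  have h1 : Continuous fun Y ↦ lse X Y ⬝ᵥ ((Xᵀ * X) *ᵥ lse X Y) := by fun_prop
  have h2 : Continuous (residVar X) := by unfold residVar; fun_prop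
  exact h1.measurable.div h2.measurable

/-- Normalized Gram matrix. -/
noncomputable def gram (X : Matrix (Fin n) (Fin p) ℝ) : Matrix (Fin p) (Fin p) ℝ :=
  (n : ℝ)⁻¹ • (Xᵀ * X)

/-- Coefficient matrix of the normalized estimation error in the errors `e / σ`. -/
noncomputable def errCoeff (σ : ℝ) (X : Matrix (Fin n) (Fin p) ℝ) : Matrix (Fin p) (Fin n) ℝ :=
  (σ * (√(n : ℝ))⁻¹) • ((gram X)⁻¹ * Xᵀ)

lemma gram_transpose (X : Matrix (Fin n) (Fin p) ℝ) : (gram X)ᵀ = gram X := by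
  simp [gram, transpose_smul, transpose_mul]

lemma inv_gram_transpose (X : Matrix (Fin n) (Fin p) ℝ) : ((gram X)⁻¹)ᵀ = (gram X)⁻¹ := by
  rw [transpose_nonsing_inv, gram_transpose]

lemma errCoeff_mul_transpose (σ : ℝ) (hX : IsUnit (gram X).det) :
    errCoeff σ X * (errCoeff σ X)ᵀ = σ ^ 2 • (gram X)⁻¹ := by
  have h1 : (gram X)⁻¹ * Xᵀ * (X * (gram X)⁻¹) = (gram X)⁻¹ * (Xᵀ * X) * (gram X)⁻¹ := by
    simp only [Matrix.mul_assoc]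
  have h2 : (gram X)⁻¹ * gram X * (gram X)⁻¹ = (gram X)⁻¹ := by
    rw [nonsing_inv_mul _ hX, Matrix.one_mul]
  rw [errCoeff, transpose_smul, transpose_mul, transpose_transpose, inv_gram_transpose,
    Matrix.smul_mul, Matrix.mul_smul, smul_smul, h1]
  have h3 : (gram X)⁻¹ = (n : ℝ)⁻¹ • ((gram X)⁻¹ * (Xᵀ * X) * (gram X)⁻¹) := by
    rw [← Matrix.smul_mul, ← Matrix.mul_smul, ← gram, h2]
  conv_rhs => rw [h3, smul_smul]
  congr 1
  have : (√(n : ℝ))⁻¹ * (√(n : ℝ))⁻¹ = (n : ℝ)⁻¹ := by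
    rw [← mul_inv, Real.mul_self_sqrt (Nat.cast_nonneg n)]
  rw [← this]; ring

/-- Writing the form as a Euclidean inner product in `ℝⁿ` makes Cauchy–Schwarz and positivity
available. -/
lemma dotProduct_inv_gram_mulVec (hX : IsUnit (gram X).det) (x y : Fin p → ℝ) :
    x ⬝ᵥ ((gram X)⁻¹ *ᵥ y) =
      (n : ℝ)⁻¹ * ((X *ᵥ ((gram X)⁻¹ *ᵥ x)) ⬝ᵥ (X *ᵥ ((gram X)⁻¹ *ᵥ y))) := by
  have h2 : (gram X)⁻¹ * gram X * (gram X)⁻¹ = (gram X)⁻¹ := by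
    rw [nonsing_inv_mul _ hX, Matrix.one_mul]
  have h3 : (X *ᵥ ((gram X)⁻¹ *ᵥ x)) ⬝ᵥ (X *ᵥ ((gram X)⁻¹ *ᵥ y)) =
      x ⬝ᵥ (((gram X)⁻¹ * (Xᵀ * X) * (gram X)⁻¹) *ᵥ y) := by
    rw [← mulVec_mulVec, ← mulVec_mulVec, ← mulVec_mulVec, dotProduct_mulVec x,
      ← mulVec_transpose, inv_gram_transpose, dotProduct_mulVec _ Xᵀ, vecMul_transpose]
  rw [h3, ← smul_eq_mul, ← dotProduct_smul, ← smul_mulVec, ← Matrix.smul_mul,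
    ← Matrix.mul_smul, ← gram, h2]

/-- Cauchy–Schwarz for the form of the inverse Gram matrix: the leverage of row `j` controls the
weight of the `j`-th error. -/
lemma sq_vecMul_errCoeff_le (σ : ℝ) (hX : IsUnit (gram X).det) (t : Fin p → ℝ) (j : Fin n) :
    (t ᵥ* errCoeff σ X) j ^ 2 ≤ σ ^ 2 * (t ⬝ᵥ ((gram X)⁻¹ *ᵥ t)) *
      ((n : ℝ)⁻¹ * (X j ⬝ᵥ ((gram X)⁻¹ *ᵥ X j))) := by
  have hj : (t ᵥ* errCoeff σ X) j = σ * (√(n : ℝ))⁻¹ * (t ⬝ᵥ ((gram X)⁻¹ *ᵥ X j)) := by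
    rw [errCoeff, vecMul_smul, ← vecMul_vecMul, dotProduct_mulVec]
    rfl
  have hCS : (t ⬝ᵥ ((gram X)⁻¹ *ᵥ X j)) ^ 2 ≤
      (t ⬝ᵥ ((gram X)⁻¹ *ᵥ t)) * (X j ⬝ᵥ ((gram X)⁻¹ *ᵥ X j)) := by
    rw [dotProduct_inv_gram_mulVec hX, dotProduct_inv_gram_mulVec hX t t,
      dotProduct_inv_gram_mulVec hX (X j) (X j), mul_pow]
    have := Finset.sum_mul_sq_le_sq_mul_sq Finset.univ (X *ᵥ ((gram X)⁻¹ *ᵥ t))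
      (X *ᵥ ((gram X)⁻¹ *ᵥ X j))
    simp only [dotProduct, ← sq]
    calc _ ≤ ((n : ℝ)⁻¹) ^ 2 * _ := mul_le_mul_of_nonneg_left this (sq_nonneg _)
      _ = _ := by ring
  have hn : ((√(n : ℝ))⁻¹) ^ 2 = (n : ℝ)⁻¹ := by
    rw [inv_pow, Real.sq_sqrt (Nat.cast_nonneg n)]
  rw [hj, mul_pow, mul_pow, hn]
  calc _ ≤ σ ^ 2 * (n : ℝ)⁻¹ * ((t ⬝ᵥ ((gram X)⁻¹ *ᵥ t)) * (X j ⬝ᵥ ((gram X)⁻¹ *ᵥ X j))) := by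
        gcongr
    _ = _ := by ring

lemma gram_smul_natCast (hn : n ≠ 0) : Xᵀ * X = (n : ℝ) • gram X := by
  rw [gram, smul_smul, mul_inv_cancel₀ (Nat.cast_ne_zero.2 hn), one_smul]

lemma isUnit_det_transpose_mul (hn : n ≠ 0) (hX : IsUnit (gram X).det) :
    IsUnit (Xᵀ * X).det := by
  rw [gram_smul_natCast hn, det_smul]
  exact ((isUnit_iff_ne_zero.2 (Nat.cast_ne_zero.2 hn)).pow _).mul hX

lemma inv_gram (hn : n ≠ 0) (hX : IsUnit (gram X).det) :
    (gram X)⁻¹ = (n : ℝ) • (Xᵀ * X)⁻¹ := by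
  refine inv_eq_left_inv ?_
  rw [gram, Matrix.smul_mul, Matrix.mul_smul, smul_smul, mul_inv_cancel₀ (Nat.cast_ne_zero.2 hn),
    one_smul, nonsing_inv_mul _ (isUnit_det_transpose_mul hn hX)]

lemma sqrt_smul_error (hn : n ≠ 0) (hX : IsUnit (gram X).det) {σ : ℝ} (hσ : σ ≠ 0)
    (e : Fin n → ℝ) :
    √(n : ℝ) • ((Xᵀ * X)⁻¹ *ᵥ (Xᵀ *ᵥ e)) = errCoeff σ X *ᵥ fun j ↦ e j / σ := by
  have he : (fun j ↦ e j / σ) = σ⁻¹ • e := by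
    ext j; simp [div_eq_inv_mul]
  have hs : √(n : ℝ) ≠ 0 := Real.sqrt_ne_zero'.2 (by positivity)
  rw [he, errCoeff, inv_gram hn hX, smul_mulVec, mulVec_smul, Matrix.smul_mul, smul_mulVec,
    smul_smul, smul_smul, mulVec_mulVec]
  congr 1
  field_simp
  exact Real.sq_sqrt (Nat.cast_nonneg n)

lemma sqrt_smul_lse (hn : n ≠ 0) (hX : IsUnit (gram X).det) {σ : ℝ} (hσ : σ ≠ 0)
    (δ : Fin p → ℝ) (e : Fin n → ℝ) :
    √(n : ℝ) • lse X (X *ᵥ localAlt δ n + e) = δ + errCoeff σ X *ᵥ fun j ↦ e j / σ := by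
  have hs : √(n : ℝ) ≠ 0 := Real.sqrt_ne_zero'.2 (by positivity)
  rw [lse_eq_add (isUnit_det_transpose_mul hn hX), smul_add, sqrt_smul_error hn hX hσ, localAlt,
    smul_smul, mul_inv_cancel₀ hs, one_smul]

lemma dotProduct_gram_sqrt_smul (hn : n ≠ 0) (x : Fin p → ℝ) :
    (√(n : ℝ) • x) ⬝ᵥ (gram X *ᵥ (√(n : ℝ) • x)) = x ⬝ᵥ ((Xᵀ * X) *ᵥ x) := by
  rw [gram_smul_natCast (X := X) hn, mulVec_smul, smul_mulVec, dotProduct_smul, smul_dotProduct,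
    dotProduct_smul, smul_smul, Real.mul_self_sqrt (Nat.cast_nonneg n)]

/-- Numerator and denominator of the test statistic as functions of the normalized least squares
estimator `w`, the mean square of the errors, `n⁻¹`, `n / (n - p)` and the normalized Gram
matrix. -/
def statMap (δ : Fin p → ℝ) (x : (Fin p → ℝ) × ℝ × ℝ × ℝ × (Fin p → Fin p → ℝ)) :
    (Fin p → ℝ) × ℝ × ℝ :=
  (x.1, x.1 ⬝ᵥ (Matrix.of x.2.2.2.2 *ᵥ x.1),
    x.2.2.2.1 * (x.2.1 - x.2.2.1 * ((x.1 - δ) ⬝ᵥ (Matrix.of x.2.2.2.2 *ᵥ (x.1 - δ)))))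

/-- Normalized error of the estimator `f L • β̃`, as a function of the normalized least squares
estimator and the numerator and denominator of `L`. -/
noncomputable def estMap (f : ℝ → ℝ) (δ : Fin p → ℝ) (y : (Fin p → ℝ) × ℝ × ℝ) : Fin p → ℝ :=
  f (y.2.1 / y.2.2) • y.1 - δ

lemma continuous_statMap (δ : Fin p → ℝ) : Continuous (statMap δ) := by
  have h : Continuous fun x : (Fin p → ℝ) × ℝ × ℝ × ℝ × (Fin p → Fin p → ℝ) ↦
      Matrix.of x.2.2.2.2 := by
    change Continuous fun x : (Fin p → ℝ) × ℝ × ℝ × ℝ × (Fin p → Fin p → ℝ) ↦ x.2.2.2.2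
    fun_prop
  unfold statMap
  fun_prop

lemma measurable_estMap {f : ℝ → ℝ} (hf : Measurable f) (δ : Fin p → ℝ) :
    Measurable (estMap f δ) := by
  unfold estMap; fun_prop

lemma continuousAt_estMap {f : ℝ → ℝ} (δ : Fin p → ℝ) {y : (Fin p → ℝ) × ℝ × ℝ}
    (hy : y.2.2 ≠ 0) (hf : ContinuousAt f (y.2.1 / y.2.2)) : ContinuousAt (estMap f δ) y := by
  have h1 : ContinuousAt (fun y : (Fin p → ℝ) × ℝ × ℝ ↦ y.2.1 / y.2.2) y :=
    ContinuousAt.div (by fun_prop) (by fun_prop) hy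
  have h2 : ContinuousAt (fun y : (Fin p → ℝ) × ℝ × ℝ ↦ f (y.2.1 / y.2.2)) y :=
    ContinuousAt.comp (f := fun y : (Fin p → ℝ) × ℝ × ℝ ↦ y.2.1 / y.2.2) hf h1
  unfold estMap
  fun_prop

/-- The factor `√n` is absorbed by passing from `XᵀX` to the Gram matrix, so the dependence on `n`
sits only in arguments that converge. -/
lemma sqrt_smul_shrink_sub (hn : n ≠ 0) (hX : IsUnit (gram X).det) {σ : ℝ} (hσ : σ ≠ 0)
    (f : ℝ → ℝ) (δ : Fin p → ℝ) (e : Fin n → ℝ) :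
    √(n : ℝ) • (f (testStat X (X *ᵥ localAlt δ n + e)) • lse X (X *ᵥ localAlt δ n + e)
        - localAlt δ n) =
      estMap f δ (statMap δ (δ + errCoeff σ X *ᵥ fun j ↦ e j / σ, (∑ j, e j ^ 2) / n, (n : ℝ)⁻¹,
        n / (n - p), fun i j ↦ gram X i j)) := by
  have hs : √(n : ℝ) ≠ 0 := Real.sqrt_ne_zero'.2 (by positivity)
  have hn' : (n : ℝ) ≠ 0 := Nat.cast_ne_zero.2 hn
  have hof : Matrix.of (fun i j ↦ gram X i j) = gram X := rfl
  have hstat : testStat X (X *ᵥ localAlt δ n + e) =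
      (statMap δ (δ + errCoeff σ X *ᵥ fun j ↦ e j / σ, (∑ j, e j ^ 2) / n, (n : ℝ)⁻¹,
        n / (n - p), fun i j ↦ gram X i j)).2.1 /
      (statMap δ (δ + errCoeff σ X *ᵥ fun j ↦ e j / σ, (∑ j, e j ^ 2) / n, (n : ℝ)⁻¹,
        n / (n - p), fun i j ↦ gram X i j)).2.2 := by
    simp only [statMap, hof]
    rw [testStat, ← dotProduct_gram_sqrt_smul hn, sqrt_smul_lse hn hX hσ,
      residVar_eq (isUnit_det_transpose_mul hn hX), ← dotProduct_gram_sqrt_smul hn,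
      sqrt_smul_error hn hX hσ, add_sub_cancel_left]
    congr 1
    simp only [dotProduct, ← sq]
    field_simp
  rw [hstat, estMap, smul_sub, smul_comm, sqrt_smul_lse hn hX hσ, localAlt, smul_smul,
    mul_inv_cancel₀ hs, one_smul]
  rfl

end Design

/-! ### Limits of the Gram matrices and negligibility of the coefficients. -/

section Asymptotics

variable {p : ℕ} {X : ∀ n : ℕ, Matrix (Fin n) (Fin p) ℝ} {C : Matrix (Fin p) (Fin p) ℝ}

lemma eventually_isUnit_det_gram (hC : C.PosDef)
    (hX : Tendsto (fun n ↦ gram (X n)) atTop (𝓝 C)) : ∀ᶠ n in atTop, IsUnit (gram (X n)).det := by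
  have hdet : Continuous fun M : Matrix (Fin p) (Fin p) ℝ ↦ M.det := by fun_prop
  filter_upwards [((hdet.tendsto C).comp hX).eventually_ne hC.det_pos.ne'] with n hn
  exact isUnit_iff_ne_zero.2 hn

lemma tendsto_inv_gram (hC : C.PosDef) (hX : Tendsto (fun n ↦ gram (X n)) atTop (𝓝 C)) :
    Tendsto (fun n ↦ (gram (X n))⁻¹) atTop (𝓝 C⁻¹) := by
  have hdet : Continuous fun M : Matrix (Fin p) (Fin p) ℝ ↦ M.det := by fun_prop
  have hadj : Continuous fun M : Matrix (Fin p) (Fin p) ℝ ↦ M.adjugate := by fun_prop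
  simp only [inv_def, Ring.inverse_eq_inv']
  exact (((hdet.tendsto C).comp hX).inv₀ hC.det_pos.ne').smul ((hadj.tendsto C).comp hX)

lemma eventually_abs_vecMul_errCoeff_lt (hC : C.PosDef)
    (hX : Tendsto (fun n ↦ gram (X n)) atTop (𝓝 C))
    (hlev : Tendsto (fun n : ℕ ↦ ⨆ j : Fin n,
      (n : ℝ)⁻¹ * (X n j ⬝ᵥ ((gram (X n))⁻¹ *ᵥ X n j))) atTop (𝓝 0))
    (σ : ℝ) (t : Fin p → ℝ) {η : ℝ} (hη : 0 < η) :
    ∀ᶠ n in atTop, ∀ j, |(t ᵥ* errCoeff σ (X n)) j| < η := by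
  have hq : Continuous fun M : Matrix (Fin p) (Fin p) ℝ ↦ σ ^ 2 * (t ⬝ᵥ (M *ᵥ t)) := by fun_prop
  have hlim := ((hq.tendsto _).comp (tendsto_inv_gram hC hX)).abs.mul hlev
  rw [mul_zero] at hlim
  filter_upwards [eventually_isUnit_det_gram hC hX,
    hlim.eventually_lt_const (show 0 < η ^ 2 by positivity)] with n hn hlt j
  have h1 := sq_vecMul_errCoeff_le σ hn t j
  have hsup : |(n : ℝ)⁻¹ * (X n j ⬝ᵥ ((gram (X n))⁻¹ *ᵥ X n j))| ≤
      ⨆ j : Fin n, (n : ℝ)⁻¹ * (X n j ⬝ᵥ ((gram (X n))⁻¹ *ᵥ X n j)) := by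
    have h0 : 0 ≤ (n : ℝ)⁻¹ * (X n j ⬝ᵥ ((gram (X n))⁻¹ *ᵥ X n j)) := by
      rw [dotProduct_inv_gram_mulVec hn]
      have := dotProduct_self_star_nonneg (X n *ᵥ ((gram (X n))⁻¹ *ᵥ X n j))
      rw [star_trivial] at this
      positivity
    rw [abs_of_nonneg h0]
    exact le_ciSup (f := fun j : Fin n ↦ (n : ℝ)⁻¹ * (X n j ⬝ᵥ ((gram (X n))⁻¹ *ᵥ X n j)))
      (Set.finite_range _).bddAbove j
  refine abs_lt_of_sq_lt_sq (h1.trans_lt (lt_of_le_of_lt ?_ hlt)) hη.le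
  refine (le_abs_self _).trans ?_
  rw [abs_mul]
  exact mul_le_mul_of_nonneg_left hsup (abs_nonneg _)

end Asymptotics

/-! ### Limit laws and asymptotic risks. -/

section Limit

variable {Ω : Type*} [MeasurableSpace Ω] {P : Measure Ω} [IsProbabilityMeasure P] {p : ℕ}
  {σ : ℝ} {e : ℕ → Ω → ℝ} {X : ∀ n : ℕ, Matrix (Fin n) (Fin p) ℝ} {C : Matrix (Fin p) (Fin p) ℝ}

/-- Asymptotic normality of the normalized least squares error. -/
lemma tendstoInDistribution_errCoeff (hσ : 0 < σ) (he_indep : iIndepFun e P)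
    (he_ident : ∀ i, IdentDistrib (e i) (e 0) P P)
    (he_mean : ∫ ω, e 0 ω ∂P = 0) (he_var : variance (e 0) P = σ ^ 2) (hC : C.PosDef)
    (hX : Tendsto (fun n ↦ gram (X n)) atTop (𝓝 C))
    (hlev : Tendsto (fun n : ℕ ↦ ⨆ j : Fin n,
      (n : ℝ)⁻¹ * (X n j ⬝ᵥ ((gram (X n))⁻¹ *ᵥ X n j))) atTop (𝓝 0))
    {D : Matrix (Fin p) (Fin p) ℝ} (hD : D * Dᵀ = σ ^ 2 • C⁻¹) (θ : Fin p → ℝ) :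
    TendstoInDistribution
      (fun (n : ℕ) ω ↦ D *ᵥ θ + errCoeff σ (X n) *ᵥ fun j : Fin n ↦ e j ω / σ) atTop
      (fun v ↦ D *ᵥ v) (fun _ ↦ P) (gaussianVec θ) := by
  have hm := (he_ident 0).aemeasurable_fst
  refine tendstoInDistribution_linear (u := fun i ω ↦ e i ω / σ)
    (he_indep.comp (fun _ x ↦ x / σ) fun _ ↦ by fun_prop)
    (fun i ↦ (he_ident i).comp (u := fun x ↦ x / σ) (by fun_prop)) ?_ ?_ ?_
    (fun t η hη ↦ eventually_abs_vecMul_errCoeff_lt hC hX hlev σ t hη) θ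
  · rw [integral_div, he_mean, zero_div]
  · simp only [Pi.pow_apply, div_pow]
    rw [integral_div, ← variance_of_integral_eq_zero hm he_mean, he_var,
      div_self (pow_ne_zero 2 hσ.ne')]
  · rw [hD]
    refine ((tendsto_inv_gram hC hX).const_smul (σ ^ 2)).congr' ?_
    filter_upwards [eventually_isUnit_det_gram hC hX] with n hn
    exact (errCoeff_mul_transpose σ hn).symm

lemma ae_tendsto_mean_sq {Ω : Type*} [MeasurableSpace Ω] {P : Measure Ω} {σ : ℝ} {e : ℕ → Ω → ℝ}
    (he_indep : iIndepFun e P)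
    (he_ident : ∀ i, IdentDistrib (e i) (e 0) P P) (he_L2 : MemLp (e 0) 2 P)
    (he_mean : ∫ ω, e 0 ω ∂P = 0) (he_var : variance (e 0) P = σ ^ 2) :
    ∀ᵐ ω ∂P, Tendsto (fun n : ℕ ↦ (∑ j : Fin n, e j ω ^ 2) / n) atTop (𝓝 (σ ^ 2)) := by
  have h := strong_law_ae_real (fun i ω ↦ e i ω ^ 2) he_L2.integrable_sq
    (fun i j hij ↦ (he_indep.indepFun hij).comp (φ := fun x ↦ x ^ 2) (ψ := fun x ↦ x ^ 2)
      (by fun_prop) (by fun_prop))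
    (fun i ↦ (he_ident i).comp (u := fun x ↦ x ^ 2) (by fun_prop))
  rw [← variance_of_integral_eq_zero (he_ident 0).aemeasurable_fst he_mean, he_var] at h
  filter_upwards [h] with ω hω
  refine hω.congr fun n ↦ ?_
  rw [Finset.sum_range]

lemma tendsto_div_sub_const (p : ℕ) :
    Tendsto (fun n : ℕ ↦ (n : ℝ) / (n - p)) atTop (𝓝 1) := by
  have h : Tendsto (fun n : ℕ ↦ (1 - (p : ℝ) * (n : ℝ)⁻¹)⁻¹) atTop (𝓝 1) := by
    have h1 := (tendsto_inv_atTop_nhds_zero_nat (𝕜 := ℝ)).const_mul (p : ℝ)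
    simpa using (h1.const_sub 1).inv₀ (by simp)
  refine h.congr' ?_
  filter_upwards [eventually_ne_atTop 0] with n hn
  have : (n : ℝ) ≠ 0 := Nat.cast_ne_zero.2 hn
  rw [show (1 : ℝ) - p * (n : ℝ)⁻¹ = (n - p) / n by field_simp, inv_div]

/-- Convergence in distribution of the normalized errors of the estimators `f L • β̃`, for
multipliers `f` that are continuous except at `c`. -/
lemma tendstoInDistribution_estMap (hσ : 0 < σ) (he_indep : iIndepFun e P)
    (he_ident : ∀ i, IdentDistrib (e i) (e 0) P P) (he_L2 : MemLp (e 0) 2 P)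
    (he_mean : ∫ ω, e 0 ω ∂P = 0) (he_var : variance (e 0) P = σ ^ 2) (hC : C.PosDef)
    (hX : Tendsto (fun n ↦ gram (X n)) atTop (𝓝 C))
    (hlev : Tendsto (fun n : ℕ ↦ ⨆ j : Fin n,
      (n : ℝ)⁻¹ * (X n j ⬝ᵥ ((gram (X n))⁻¹ *ᵥ X n j))) atTop (𝓝 0))
    {D : Matrix (Fin p) (Fin p) ℝ} (hD : D * Dᵀ = σ ^ 2 • C⁻¹) (hDC : Dᵀ * C * D = σ ^ 2 • 1)
    {c : ℝ} (hc : 0 < c) {f : ℝ → ℝ} (hf : Measurable f) (hfc : ∀ x, x ≠ c → ContinuousAt f x)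
    (θ : Fin p → ℝ) :
    TendstoInDistribution
      (fun (n : ℕ) ω ↦ estMap f (D *ᵥ θ) (statMap (D *ᵥ θ)
        (D *ᵥ θ + errCoeff σ (X n) *ᵥ fun j : Fin n ↦ e j ω / σ, (∑ j : Fin n, e j ω ^ 2) / n,
          (n : ℝ)⁻¹, n / (n - p), fun i j ↦ gram (X n) i j))) atTop
      (fun v ↦ f (v ⬝ᵥ v) • (D *ᵥ v) - D *ᵥ θ) (fun _ ↦ P) (gaussianVec θ) := by
  have hm (i : ℕ) := (he_ident i).aemeasurable_fst
  have hY (n : ℕ) : AEMeasurable (fun ω ↦ ((∑ j : Fin n, e j ω ^ 2) / (n : ℝ), (n : ℝ)⁻¹,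
      (n : ℝ) / (n - p), fun i j ↦ gram (X n) i j)) P :=
    AEMeasurable.prodMk ((Finset.aemeasurable_fun_sum Finset.univ
      fun (j : Fin n) _ ↦ (hm j).pow_const 2).div_const _) aemeasurable_const
  have hYlim : TendstoInMeasure P (fun (n : ℕ) ω ↦ ((∑ j : Fin n, e j ω ^ 2) / (n : ℝ), (n : ℝ)⁻¹,
      (n : ℝ) / (n - p), fun i j ↦ gram (X n) i j)) atTop
      (fun _ ↦ (σ ^ 2, 0, 1, fun i j ↦ C i j)) := by
    refine tendstoInMeasure_of_tendsto_ae (fun n ↦ (hY n).aestronglyMeasurable) ?_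
    filter_upwards [ae_tendsto_mean_sq he_indep he_ident he_L2 he_mean he_var] with ω hω
    exact hω.prodMk_nhds (tendsto_inv_atTop_nhds_zero_nat.prodMk_nhds
      ((tendsto_div_sub_const p).prodMk_nhds hX))
  -- Slutsky: all arguments except the normalized estimator converge in probability to constants.
  have hstat := (tendstoInDistribution_errCoeff hσ he_indep he_ident he_mean he_var hC hX hlev hD
    θ).continuous_comp_prodMk_of_tendstoInMeasure_const (continuous_statMap (D *ᵥ θ)) hYlim hY
  -- The correction to the residual variance carries the factor `n⁻¹`, which becomes `0`, so the
  -- denominator tends to `σ²` and the ratio to `v ⬝ᵥ v`.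
  have hlim (v : Fin p → ℝ) : statMap (D *ᵥ θ) (D *ᵥ v, σ ^ 2, 0, 1, fun i j ↦ C i j) =
      (D *ᵥ v, σ ^ 2 * (v ⬝ᵥ v), σ ^ 2) := by
    have hof : Matrix.of (fun i j ↦ C i j) = C := rfl
    have hq : (D *ᵥ v) ⬝ᵥ (C *ᵥ (D *ᵥ v)) = σ ^ 2 * (v ⬝ᵥ v) := by
      have h1 : v ⬝ᵥ ((Dᵀ * C * D) *ᵥ v) = σ ^ 2 * (v ⬝ᵥ v) := by
        rw [hDC, smul_mulVec, one_mulVec, dotProduct_smul, smul_eq_mul]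
      rw [← h1, ← mulVec_mulVec, ← mulVec_mulVec, dotProduct_mulVec v Dᵀ, vecMul_transpose]
    simp only [statMap, hof, hq, zero_mul, sub_zero, one_mul]
  have hσ2 : σ ^ 2 ≠ 0 := pow_ne_zero 2 hσ.ne'
  simp_rw [hlim] at hstat
  have hest := tendstoInDistribution_comp_of_ae_continuousAt
    (measurable_estMap hf (D *ᵥ θ)) hstat ?_
  · simpa only [estMap, mul_div_cancel_left₀ _ hσ2] using hest
  · have hnull : ∀ᵐ v ∂gaussianVec θ, v ⬝ᵥ v ≠ c := by
      rw [ae_iff]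
      simpa using gaussianVec_dotProduct_self_eq hc θ
    filter_upwards [hnull] with v hv
    refine continuousAt_estMap _ hσ2 ?_
    simp only [mul_div_cancel_left₀ _ hσ2]
    exact hfc _ hv

/-- Asymptotic risk of the estimators `f L • β̃` under local alternatives. -/
theorem hasADQR_shrink (hσ : 0 < σ) (he_indep : iIndepFun e P)
    (he_ident : ∀ i, IdentDistrib (e i) (e 0) P P) (he_L2 : MemLp (e 0) 2 P)
    (he_mean : ∫ ω, e 0 ω ∂P = 0) (he_var : variance (e 0) P = σ ^ 2) (hC : C.PosDef)
    (hX : Tendsto (fun n ↦ gram (X n)) atTop (𝓝 C))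
    (hlev : Tendsto (fun n : ℕ ↦ ⨆ j : Fin n,
      (n : ℝ)⁻¹ * (X n j ⬝ᵥ ((gram (X n))⁻¹ *ᵥ X n j))) atTop (𝓝 0))
    {D : Matrix (Fin p) (Fin p) ℝ} {l : Fin p → ℝ} (hD : D * Dᵀ = σ ^ 2 • C⁻¹)
    (hDC : Dᵀ * C * D = σ ^ 2 • 1) (hDl : Dᵀ * D = σ ^ 2 • diagonal l)
    {c : ℝ} (hc : 0 < c) {f : ℝ → ℝ} (hf : Measurable f) (hfc : ∀ x, x ≠ c → ContinuousAt f x)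
    {b : ℝ} (hfb : ∀ v : Fin p → ℝ, |f (v ⬝ᵥ v)| ≤ b) (θ : Fin p → ℝ) :
    HasADQR P 1 (localAlt (D *ᵥ θ))
      (fun n ω ↦ f (testStat (X n) (response X e (D *ᵥ θ) n ω)) •
        lse (X n) (response X e (D *ᵥ θ) n ω))
      (σ ^ 2 * ∫ v, shrinkLoss l θ (fun v ↦ f (v ⬝ᵥ v)) v ∂gaussianVec θ) := by
  have hlim := tendstoInDistribution_estMap hσ he_indep he_ident he_L2 he_mean he_var hC hX hlev
    hD hDC hc hf hfc θ
  have hκ : Measurable fun v : Fin p → ℝ ↦ f (v ⬝ᵥ v) := hf.comp measurable_dotProduct_self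
  set T : (Fin p → ℝ) → Fin p → ℝ := fun v ↦ f (v ⬝ᵥ v) • (D *ᵥ v) - D *ᵥ θ with hT
  have hTm : AEMeasurable T (gaussianVec θ) := hlim.aemeasurable_limit
  have hform (v : Fin p → ℝ) : T v ⬝ᵥ ((1 : Matrix (Fin p) (Fin p) ℝ) *ᵥ T v) =
      σ ^ 2 * shrinkLoss l θ (fun v ↦ f (v ⬝ᵥ v)) v := by
    have h1 : T v = D *ᵥ (f (v ⬝ᵥ v) • v - θ) := by rw [hT, mulVec_sub, mulVec_smul]
    have h2 (w : Fin p → ℝ) : (D *ᵥ w) ⬝ᵥ (D *ᵥ w) = σ ^ 2 * ∑ i, l i * w i ^ 2 := by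
      rw [dotProduct_comm, dotProduct_mulVec, ← mulVec_transpose, mulVec_mulVec, hDl,
        dotProduct_comm, smul_mulVec,
        dotProduct_smul, smul_eq_mul]
      congr 1
      simp only [dotProduct, mulVec_diagonal]
      exact Finset.sum_congr rfl fun i _ ↦ by ring
    rw [one_mulVec, h1, h2, shrinkLoss]
    simp
  have hq : Continuous fun x : Fin p → ℝ ↦ x ⬝ᵥ ((1 : Matrix (Fin p) (Fin p) ℝ) *ᵥ x) := by
    fun_prop
  have hresp (n : ℕ) : AEMeasurable (fun ω ↦ response X e (D *ᵥ θ) n ω) P := by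
    have h1 : AEMeasurable (fun ω (j : Fin n) ↦ e j ω) P :=
      aemeasurable_pi_lambda _ fun j ↦ (he_ident j).aemeasurable_fst
    exact (measurable_const_add (X n *ᵥ localAlt (D *ᵥ θ) n)).comp_aemeasurable h1
  -- Measurability is required for every `n`, also where the Gram matrix is singular and the
  -- representation by `estMap` is not available.
  have hest (n : ℕ) : AEMeasurable (fun ω ↦ √(n : ℝ) •
      (f (testStat (X n) (response X e (D *ᵥ θ) n ω)) •
        lse (X n) (response X e (D *ᵥ θ) n ω) - localAlt (D *ᵥ θ) n)) P := by
    have h1 : Measurable fun Y : Fin n → ℝ ↦ √(n : ℝ) •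
        (f (testStat (X n) Y) • lse (X n) Y - localAlt (D *ᵥ θ) n) := by
      have h2 := hf.comp (measurable_testStat (X n))
      have h3 := (continuous_lse (X n)).measurable
      exact (measurable_const_smul _).comp ((h2.smul h3).sub_const _)
    exact h1.comp_aemeasurable (hresp n)
  have hprob := Measure.isProbabilityMeasure_map hTm
  refine ⟨(gaussianVec θ).map T, hprob, ⟨hest, aemeasurable_id, ?_⟩, ?_, ?_⟩
  · have h := hlim.tendsto
    have hG : (⟨((gaussianVec θ).map T).map id, Measure.isProbabilityMeasure_map aemeasurable_id⟩ :
        ProbabilityMeasure (Fin p → ℝ)) = ⟨(gaussianVec θ).map T, hprob⟩ :=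
      Subtype.ext Measure.map_id
    rw [hG]
    refine h.congr' ?_
    filter_upwards [eventually_isUnit_det_gram hC hX, eventually_ne_atTop 0] with n hn hn0
    refine Subtype.ext ?_
    simp only
    congr 1
    ext1 ω
    exact (sqrt_smul_shrink_sub hn0 hn hσ.ne' f (D *ᵥ θ) fun j ↦ e j ω).symm
  · rw [integrable_map_measure hq.aestronglyMeasurable hTm]
    exact ((integrable_shrinkLoss l θ hκ hfb).const_mul (σ ^ 2)).congr
      (ae_of_all _ fun v ↦ (hform v).symm)
  · rw [integral_map hTm hq.aestronglyMeasurable]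
    simp_rw [hform]
    rw [integral_const_mul]

end Limit

/-! ### The two multipliers. -/

/-- Multiplier of the preliminary test estimator. -/
noncomputable def ptMult (c x : ℝ) : ℝ := if x < c then 0 else 1

/-- Multiplier of the improved preliminary test estimator. -/
noncomputable def iptMult (p : ℕ) (c x : ℝ) : ℝ := (1 - ((p : ℝ) - 2) * x⁻¹) * ptMult c x

lemma measurable_ptMult (c : ℝ) : Measurable (ptMult c) :=
  Measurable.ite measurableSet_Iio measurable_const measurable_const

lemma measurable_iptMult (p : ℕ) (c : ℝ) : Measurable (iptMult p c) := by
  have := measurable_ptMult c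
  unfold iptMult; fun_prop

lemma continuousAt_ptMult {c x : ℝ} (hx : x ≠ c) : ContinuousAt (ptMult c) x := by
  rcases hx.lt_or_gt with h | h
  · refine (continuousAt_const (y := (0 : ℝ))).congr ?_
    filter_upwards [Iio_mem_nhds h] with y hy
    exact (if_pos hy).symm
  · refine (continuousAt_const (y := (1 : ℝ))).congr ?_
    filter_upwards [Ioi_mem_nhds h] with y hy
    exact (if_neg (not_lt.2 (le_of_lt hy))).symm

lemma continuousAt_iptMult (p : ℕ) {c x : ℝ} (hc : 0 < c) (hx : x ≠ c) :
    ContinuousAt (iptMult p c) x := by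
  rcases hx.lt_or_gt with h | h
  -- Below `c` the multiplier is locally zero, which removes the singularity of `x⁻¹` at the origin.
  · refine (continuousAt_const (y := (0 : ℝ))).congr ?_
    filter_upwards [Iio_mem_nhds h] with y hy
    rw [iptMult, ptMult, if_pos (Set.mem_Iio.1 hy), mul_zero]
  · have hinv := continuousAt_inv₀ (hc.trans h).ne'
    exact (continuousAt_const.sub (continuousAt_const.mul hinv)).mul (continuousAt_ptMult hx)

lemma ptMult_dotProduct {p : ℕ} (c : ℝ) (v : Fin p → ℝ) : ptMult c (v ⬝ᵥ v) = ptFactor c v := by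
  simp only [ptMult, ptFactor, ← not_lt, ite_not]

lemma iptMult_dotProduct {p : ℕ} (c : ℝ) (v : Fin p → ℝ) :
    iptMult p c (v ⬝ᵥ v) = iptFactor c v := by
  rw [iptMult, ptMult_dotProduct, iptFactor]

lemma prelimTest_eq {n p : ℕ} (α : ℝ) (X : Matrix (Fin n) (Fin p) ℝ) (Y : Fin n → ℝ) :
    prelimTest α X Y = ptMult (chiSqCrit p α) (testStat X Y) • lse X Y := by
  unfold prelimTest ptMult
  split_ifs <;> simp

lemma improvedPrelimTest_eq {n p : ℕ} (α : ℝ) (X : Matrix (Fin n) (Fin p) ℝ) (Y : Fin n → ℝ) :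
    improvedPrelimTest α X Y = iptMult p (chiSqCrit p α) (testStat X Y) • lse X Y := by
  rw [improvedPrelimTest, prelimTest_eq, smul_smul, iptMult]

end LinReg

/-! ### Assembly. -/

theorem mainTheorem1 {Ω : Type*} [MeasurableSpace Ω] (P : Measure Ω) [IsProbabilityMeasure P]
    (p : ℕ) (hp : 3 ≤ p)
    -- i.i.d. errors with mean zero and variance `σ²`
    (σ : ℝ) (hσ : 0 < σ) (e : ℕ → Ω → ℝ)
    (he_indep : iIndepFun e P) (he_ident : ∀ i, IdentDistrib (e i) (e 0) P P)
    (he_L2 : MemLp (e 0) 2 P) (he_mean : ∫ ω, e 0 ω ∂P = 0) (he_var : variance (e 0) P = σ ^ 2)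
    -- design matrices with `XᵀX / n → C` and asymptotically negligible leverages
    (X : ∀ n : ℕ, Matrix (Fin n) (Fin p) ℝ) (C : Matrix (Fin p) (Fin p) ℝ) (hC : C.PosDef)
    (hX : Tendsto (fun n : ℕ => (n : ℝ)⁻¹ • ((X n)ᵀ * X n)) atTop (𝓝 C))
    (hX_lev : Tendsto (fun n : ℕ => ⨆ j : Fin n,
      (n : ℝ)⁻¹ * (X n j ⬝ᵥ (((n : ℝ)⁻¹ • ((X n)ᵀ * X n))⁻¹ *ᵥ X n j))) atTop (𝓝 0))
    (hC_tr : ((p : ℝ) + 2) / 2 ≤ trace C⁻¹ / LinReg.chMax C⁻¹) :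
    ∀ α ∈ Set.Ioo (0 : ℝ) 1, ∃ R_PT R_IPT : (Fin p → ℝ) → ℝ,
      (∀ δ : Fin p → ℝ, δ ≠ 0 →
        LinReg.HasADQR P 1 (LinReg.localAlt δ)
          (fun n ω => LinReg.prelimTest α (X n) (LinReg.response X e δ n ω)) (R_PT δ) ∧
        LinReg.HasADQR P 1 (LinReg.localAlt δ)
          (fun n ω => LinReg.improvedPrelimTest α (X n) (LinReg.response X e δ n ω)) (R_IPT δ)) ∧
      LinReg.Dominates R_IPT R_PT := by
  intro α hα
  have hc := LinReg.chiSqCrit_pos (show 0 < p by omega) hα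
  obtain ⟨A, l, hAA, hAl, hAC, hl, hlmax, htr⟩ := LinReg.exists_diagonalizing_sqrt_inv hC
  have hD : (σ • A) * (σ • A)ᵀ = σ ^ 2 • C⁻¹ := by
    rw [transpose_smul, Matrix.smul_mul, Matrix.mul_smul, smul_smul, hAA, sq]
  have hDl : (σ • A)ᵀ * (σ • A) = σ ^ 2 • diagonal l := by
    rw [transpose_smul, Matrix.smul_mul, Matrix.mul_smul, smul_smul, hAl, sq]
  have hDC : (σ • A)ᵀ * C * (σ • A) = σ ^ 2 • 1 := by
    rw [transpose_smul, Matrix.smul_mul, Matrix.smul_mul, Matrix.mul_smul, smul_smul, hAC, sq]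
  have hcond (i : Fin p) : ((p : ℝ) + 2) * l i ≤ 2 * ∑ j, l j := by
    have hmax : 0 < LinReg.chMax C⁻¹ := (hl i).trans_le (hlmax i)
    rw [le_div_iff₀ hmax, ← htr] at hC_tr
    nlinarith [hlmax i, (Nat.cast_nonneg p : (0 : ℝ) ≤ p)]
  -- Since `Aᵀ C A = 1`, the matrix `σ⁻¹ Aᵀ C` inverts `D = σ A`, so every `δ` is `D θ` for this
  -- `θ`.
  set θ : (Fin p → ℝ) → Fin p → ℝ := fun δ ↦ (σ⁻¹ • (Aᵀ * C)) *ᵥ δ with hθ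
  have hDθ (δ : Fin p → ℝ) : (σ • A) *ᵥ θ δ = δ := by
    have h1 : A * (Aᵀ * C) = 1 := mul_eq_one_comm.1 hAC
    rw [hθ, mulVec_mulVec, Matrix.smul_mul, Matrix.mul_smul, smul_smul, h1,
      mul_inv_cancel₀ hσ.ne', one_smul, one_mulVec]
  set c := LinReg.chiSqCrit p α with hcdef
  have hlt (δ : Fin p → ℝ) := mul_lt_mul_of_pos_left
    (LinReg.integral_shrinkLoss_iptFactor_lt hp hc hl hcond (θ δ)) (pow_pos hσ 2)
  -- The inequality is strict for all `δ`; the all-ones vector is an arbitrary nonzero witness.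
  refine ⟨fun δ ↦ σ ^ 2 * ∫ v, LinReg.shrinkLoss l (θ δ) (LinReg.ptFactor c) v
      ∂LinReg.gaussianVec (θ δ),
    fun δ ↦ σ ^ 2 * ∫ v, LinReg.shrinkLoss l (θ δ) (LinReg.iptFactor c) v
      ∂LinReg.gaussianVec (θ δ), fun δ _ ↦ ⟨?_, ?_⟩, fun δ _ ↦ (hlt δ).le, fun _ ↦ 1, ?_, hlt _⟩
  · have h := LinReg.hasADQR_shrink hσ he_indep he_ident he_L2 he_mean he_var hC hX hX_lev hD hDC
      hDl hc (LinReg.measurable_ptMult c) (fun x hx ↦ LinReg.continuousAt_ptMult hx)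
      (fun v ↦ (congrArg abs (LinReg.ptMult_dotProduct c v)).trans_le (LinReg.abs_ptFactor_le c v))
      (θ δ)
    rw [hDθ] at h
    simpa only [LinReg.prelimTest_eq, LinReg.ptMult_dotProduct] using h
  · have h := LinReg.hasADQR_shrink hσ he_indep he_ident he_L2 he_mean he_var hC hX hX_lev hD hDC
      hDl hc (LinReg.measurable_iptMult p c) (fun x hx ↦ LinReg.continuousAt_iptMult p hc hx)
      (fun v ↦ (congrArg abs (LinReg.iptMult_dotProduct c v)).trans_le
        (LinReg.abs_iptFactor_le hc v)) (θ δ)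
    rw [hDθ] at h
    simpa only [LinReg.improvedPrelimTest_eq, LinReg.iptMult_dotProduct] using h
  · intro h
    exact one_ne_zero (congrFun h ⟨0, by omega⟩)
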